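/- **Definitions.** The square grid is the graph on $\mathbb{Z}^2$ in which two points are adjacent when they are at distance $1$ horizontally or vertically. A vertical edge $\{(a,b),(a,b+1)\}$ is called even or odd according to the parity of $a+b$. A *standard pinecone* is a finite subgraph $P$ of the square grid such that, for some integers $p\ge 1$, $q\ge 0$: (1) its horizontal edges form $p+q+1$ segments of odd lengths, one at each ordinate $y\in\{-q,\dots,p\}$, the segment at ordinate $y$ having leftmost point $(y-1,y)$ if $y\ge 1$ and $(-y,y)$ if $y\le 0$; their lengths $\Lambda_y$ satisfy $\Lambda_{-q}<\cdots<\Lambda_{-1}<\Lambda_0=\Lambda_1>\Lambda_2>\cdots>\Lambda_p$; (2) its vertices are the endpoints of these horizontal edges; (3) it contains every even vertical edge of the grid that joins two of its vertices (odd vertical edges between its vertices may or may not be present). It is *closed* if it has no vertex of degree $1$; the empty graph is also counted as a closed standard pinecone. Let $i,j,k,\ell$ be positive integers with $i+j=k+\ell=m$ and $j=\min\{i,j,k,\ell\}$. For integers $n,r,c\ge 0$ put $$U(n,r,c)=2c+r-3-2\left\lfloor\frac{mc+kr+i-n-1}{j}\right\rfloor,\qquad L(n,r,c)=2c+r-3-2\left\lfloor\frac{mc+\ell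 r+i-n-1}{j}\right\rfloor .$$ The graph $P(n)=P(n;i,j,k,\ell)$ is defined as follows. Its horizontal edges are the unit edges of the segments from $(r,r+1)$ to $(U(n,r,0),r+1)$ for all $r\ge 0$ with $U(n,r,0)>r$, and of the segments from $(r,-r)$ to $(L(n,r,0),-r)$ for all $r\ge 0$ with $L(n,r,0)>r$. Its vertices are the endpoints of these horizontal edges. Its vertical edges are all even vertical edges of the grid joining two of its vertices, together with the odd vertical edges, joining two of its vertices, whose lower vertex lies in $$S(n)=\{(U(n,r,c),r): r,c\ge 0,\ U(n,r,c)>r\}\cup\{(L(n,r,c),-r): r,c\ge 0,\ L(n,r,c)>r\}.$$ Let $a(n)$ be the number of perfect matchings of $P(n)$ (the empty graph has exactly one). **Theorem.** For all such $i,j,k,\ell$: 1. for every $n\ge 0$, $P(n)$ is a finite subgraph of the square grid and is a closed standard pinecone, and the set of lower vertices of its odd vertical edges is exactly $S(n)$; 2. $a(n)=1$ for $0\le n<m$; 3. for all $n\ge m$, $$a(n)\,a(n-m)=a(n-i)\,a(n-j)+a(n-k)\,a(n-\ell).$$ -/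

import Mathlib

namespace GaleRobinson

/-- The square grid (square lattice) on `ℤ × ℤ`: two points are joined when they are at
distance one along one of the coordinate axes. -/
def squareGrid : SimpleGraph (ℤ × ℤ) where
  Adj p q := (p.1 = q.1 ∧ |p.2 - q.2| = 1) ∨ (p.2 = q.2 ∧ |p.1 - q.1| = 1)
  symm := ⟨fun p q h => by
    rcases h with ⟨h1, h2⟩ | ⟨h1, h2⟩
    · exact Or.inl ⟨h1.symm, by rw [abs_sub_comm]; exact h2⟩
    · exact Or.inr ⟨h1.symm, by rw [abs_sub_comm]; exact h2⟩⟩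
  loopless := ⟨fun p h => by simp at h⟩

/-- The matching number of a subgraph of the square grid: the number of its perfect matchings. -/
noncomputable def matchingNumber (P : squareGrid.Subgraph) : ℕ :=
  Nat.card {M : P.coe.Subgraph // M.IsPerfectMatching}

/-! ### Pinecones in general -/

/-- Abscissa of the leftmost vertex of a standard pinecone at ordinate `y`: the horizontal
segments start at `(0,1), (1,2), (2,3), …` and at `(0,0), (1,-1), (2,-2), …`. -/
def segStart (y : ℤ) : ℤ := if 1 ≤ y then y - 1 else -y

/-- `P` is a (nonempty) standard pinecone. -/
def IsStandardPinecone (P : squareGrid.Subgraph) : Prop :=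
  ∃ (top bot width : ℤ) (len : ℤ → ℤ),
    1 ≤ top ∧ 0 ≤ bot ∧
    -- the lengths of the horizontal segments, at the ordinates from `-bot` to `top`
    (∀ y ∈ Set.Icc (-bot) top, 0 < len y ∧ Odd (len y)) ∧
    len 0 = width ∧ len 1 = width ∧
    StrictMonoOn len (Set.Icc (-bot) 0) ∧ StrictAntiOn len (Set.Icc 1 top) ∧
    -- the horizontal edges form exactly these segments
    (∀ x y : ℤ, P.Adj (x, y) (x + 1, y) ↔
      y ∈ Set.Icc (-bot) top ∧ segStart y ≤ x ∧ x < segStart y + len y) ∧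
    -- the vertices are the points incident to the horizontal edges
    (∀ x y : ℤ, (x, y) ∈ P.verts ↔ P.Adj (x, y) (x + 1, y) ∨ P.Adj (x - 1, y) (x, y)) ∧
    -- every even vertical edge of the grid between two vertices is present
    (∀ x y : ℤ, Even (x + y) → (x, y) ∈ P.verts → (x, y + 1) ∈ P.verts →
      P.Adj (x, y) (x, y + 1))

/-- `P` is a closed standard pinecone: a standard pinecone without vertices of degree `1`,
or the empty graph. -/
def IsClosedStandardPinecone (P : squareGrid.Subgraph) : Prop :=
  P = ⊥ ∨ (IsStandardPinecone P ∧ ∀ v ∈ P.verts, (P.neighborSet v).ncard ≠ 1)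

/-- The odd vertical edges of `P`, each given by its lower vertex. -/
def oddEdges (P : squareGrid.Subgraph) : Set (ℤ × ℤ) :=
  {v | Odd (v.1 + v.2) ∧ P.Adj v (v.1, v.2 + 1)}

/-! ### The pinecones of the Gale-Robinson sequences -/

/-- The upper function `U(n,r,c)`, where `m = i + j`. For a positive divisor, `/` on `ℤ` is the
floor of the quotient. -/
def U (i j k n r c : ℕ) : ℤ :=
  2 * c + r - 3 - 2 * ((((i : ℤ) + j) * c + k * r + i - n - 1) / (j : ℤ))

/-- The lower function `L(n,r,c)`, where `m = i + j`. -/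
def L (i j ℓ n r c : ℕ) : ℤ :=
  2 * c + r - 3 - 2 * ((((i : ℤ) + j) * c + ℓ * r + i - n - 1) / (j : ℤ))

/-- The lower vertices of the prescribed odd vertical edges: in row `r ≥ 0` at the abscissas
`U(n,r,c) > r`, and in row `-r ≤ 0` at the abscissas `L(n,r,c) > r`. -/
def oddSet (i j k ℓ n : ℕ) : Set (ℤ × ℤ) :=
  {v | ∃ r c : ℕ, (v = (U i j k n r c, (r : ℤ)) ∧ (r : ℤ) < U i j k n r c) ∨
    (v = (L i j ℓ n r c, -(r : ℤ)) ∧ (r : ℤ) < L i j ℓ n r c)}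

/-- The horizontal edge from `(x,y)` to `(x+1,y)` is drawn: for `r ≥ 0` there are horizontal
edges from `(r,r+1)` to `(U(n,r,0),r+1)` and from `(r,-r)` to `(L(n,r,0),-r)` (none if
`U(n,r,0) ≤ r`, respectively `L(n,r,0) ≤ r`). -/
def HEdge (i j k ℓ n : ℕ) (x y : ℤ) : Prop :=
  ∃ r : ℕ, (y = r + 1 ∧ (r : ℤ) ≤ x ∧ x < U i j k n r 0) ∨
    (y = -(r : ℤ) ∧ (r : ℤ) ≤ x ∧ x < L i j ℓ n r 0)

/-- The endpoints of the horizontal edges. -/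
def pineVerts (i j k ℓ n : ℕ) : Set (ℤ × ℤ) :=
  {v | HEdge i j k ℓ n v.1 v.2 ∨ HEdge i j k ℓ n (v.1 - 1) v.2}

/-- The edges of `P(n;i,j,k,ℓ)`, oriented to the right or upwards: the horizontal edges, and,
between two vertices, all even vertical edges and the prescribed odd vertical edges. -/
def PineEdge (i j k ℓ n : ℕ) (v w : ℤ × ℤ) : Prop :=
  (w = (v.1 + 1, v.2) ∧ HEdge i j k ℓ n v.1 v.2) ∨
  (w = (v.1, v.2 + 1) ∧ v ∈ pineVerts i j k ℓ n ∧ w ∈ pineVerts i j k ℓ n ∧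
    (Even (v.1 + v.2) ∨ v ∈ oddSet i j k ℓ n))

theorem PineEdge.adj {i j k ℓ n : ℕ} {v w : ℤ × ℤ} (h : PineEdge i j k ℓ n v w) :
    squareGrid.Adj v w := by
  rcases h with ⟨rfl, -⟩ | ⟨rfl, -⟩
  · exact Or.inr ⟨rfl, by simp⟩
  · exact Or.inl ⟨rfl, by simp⟩

theorem PineEdge.left_mem {i j k ℓ n : ℕ} {v w : ℤ × ℤ} (h : PineEdge i j k ℓ n v w) :
    v ∈ pineVerts i j k ℓ n := by
  rcases h with ⟨-, h⟩ | ⟨-, h, -⟩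
  · exact Or.inl h
  · exact h

theorem PineEdge.right_mem {i j k ℓ n : ℕ} {v w : ℤ × ℤ} (h : PineEdge i j k ℓ n v w) :
    w ∈ pineVerts i j k ℓ n := by
  rcases h with ⟨rfl, h⟩ | ⟨-, -, h, -⟩
  · exact Or.inr (by simpa using h)
  · exact h

/-- The pinecone `P(n;i,j,k,ℓ)`. -/
def pinecone (n i j k ℓ : ℕ) : squareGrid.Subgraph where
  verts := pineVerts i j k ℓ n
  Adj v w := PineEdge i j k ℓ n v w ∨ PineEdge i j k ℓ n w v
  adj_sub h := h.elim (fun h => h.adj) (fun h => h.adj.symm)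
  edge_vert h := h.elim (fun h => h.left_mem) (fun h => h.right_mem)
  symm := ⟨fun _ _ h => h.symm⟩

end GaleRobinson

namespace GaleRobinson

open Equiv

/-- `1` on the rows above `z`, and `-1` on the other ones. -/
def eps (z y : ℤ) : ℤ := if z < y then 1 else -1

/-- In the row of `c`, above `z` the vertex `c` is paired with its left neighbour, otherwise with
its right neighbour. `Arc z O b c` says that `b` is adjacent to the partner of `c`, where the
vertical edges `{v, v + (0, 1)}` are allowed for even `v` and for `v ∈ O`. -/
def Arc (z : ℤ) (O : Set (ℤ × ℤ)) (b c : ℤ × ℤ) : Prop :=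
  (c.2 = b.2 ∧ (c.1 = b.1 ∨ c.1 = b.1 + 2 * eps z c.2)) ∨
  (c.2 = b.2 + 1 ∧ c.1 = b.1 + eps z c.2) ∨
  (c.2 = b.2 - 1 ∧ c.1 = b.1 + eps z c.2 ∧ (b.1, b.2 - 1) ∈ O)

theorem Arc.rfl' {z : ℤ} {O : Set (ℤ × ℤ)} (b : ℤ × ℤ) : Arc z O b b := Or.inl ⟨rfl, Or.inl rfl⟩

/-- The Kasteleyn sign of an arc. -/
def wt (b c : ℤ × ℤ) : ℤˣ := if c.2 = b.2 - 1 then -1 else 1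

@[simp] theorem wt_self (b : ℤ × ℤ) : wt b b = 1 := if_neg (by omega)

theorem prod_mul_swap {X M : Type*} [Fintype X] [DecidableEq X] [CommMonoid M] (F : X → X → M)
    (π : Perm X) {x y : X} (h : x ≠ y) :
    (∏ b, F b ((π * swap x y) b)) * (F x (π x) * F y (π y)) =
      (∏ b, F b (π b)) * (F x (π y) * F y (π x)) := by
  have key : ∀ G : X → M, ∏ b, G b = (G x * G y) * ∏ b ∈ (Finset.univ.erase x).erase y, G b := by
    intro G
    rw [← Finset.mul_prod_erase _ _ (Finset.mem_univ x),
      ← Finset.mul_prod_erase (Finset.univ.erase x) _ (Finset.mem_erase.2 ⟨h.symm, Finset.mem_univ y⟩),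
      mul_assoc]
  rw [key, key (fun b => F b (π b))]
  have : ∏ b ∈ (Finset.univ.erase x).erase y, F b ((π * swap x y) b) =
      ∏ b ∈ (Finset.univ.erase x).erase y, F b (π b) := by
    refine Finset.prod_congr rfl fun b hb => ?_
    simp only [Finset.mem_erase] at hb
    rw [Perm.mul_apply, swap_apply_of_ne_of_ne hb.2.1 hb.1]
  rw [this]
  simp only [Perm.mul_apply, swap_apply_left, swap_apply_right]
  ac_rfl

theorem sum_mul_swap {X M : Type*} [Fintype X] [DecidableEq X] [AddCommMonoid M] (F : X → X → M)
    (π : Perm X) {x y : X} (h : x ≠ y) :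
    (∑ b, F b ((π * swap x y) b)) + (F x (π x) + F y (π y)) =
      (∑ b, F b (π b)) + (F x (π y) + F y (π x)) :=
  prod_mul_swap (M := Multiplicative M) F π h

theorem prod_mul_cycle {X M : Type*} [Fintype X] [DecidableEq X] [CancelCommMonoid M]
    (F : X → X → M) (π : Perm X) {b c e : X} (hbc : b ≠ c) (hbe : b ≠ e) (hce : c ≠ e) :
    (∏ a, F a ((π * swap b c * swap b e) a)) * (F b (π b) * F c (π c) * F e (π e)) =
      (∏ a, F a (π a)) * (F b (π e) * F e (π c) * F c (π b)) := by
  have h1 := prod_mul_swap F π hbc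
  have h2 := prod_mul_swap F (π * swap b c) hbe
  simp only [Perm.mul_apply, swap_apply_left, swap_apply_of_ne_of_ne hbe.symm hce.symm] at h1 h2
  refine mul_right_cancel (b := F b (π c)) ?_
  simp only [Perm.mul_apply]
  calc _ = ((∏ a, F a (π (swap b c (swap b e a)))) * (F b (π c) * F e (π e))) *
        (F b (π b) * F c (π c)) := by ac_rfl
    _ = ((∏ a, F a (π (swap b c a))) * (F b (π b) * F c (π c))) * (F b (π e) * F e (π c)) := by
        rw [h2]; ac_rfl
    _ = _ := by rw [h1]; ac_rfl

theorem sum_mul_cycle {X M : Type*} [Fintype X] [DecidableEq X] [AddCancelCommMonoid M]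
    (F : X → X → M) (π : Perm X) {b c e : X} (hbc : b ≠ c) (hbe : b ≠ e) (hce : c ≠ e) :
    (∑ a, F a ((π * swap b c * swap b e) a)) + (F b (π b) + F c (π c) + F e (π e)) =
      (∑ a, F a (π a)) + (F b (π e) + F e (π c) + F c (π b)) :=
  prod_mul_cycle (M := Multiplicative M) F π hbc hbe hce

section sign

variable {B : Set (ℤ × ℤ)} [Fintype B]

/-- The total Kasteleyn sign of a permutation. -/
noncomputable def ksign (π : Perm B) : ℤˣ := Perm.sign π * ∏ b : B, wt b.1 (π b).1

/-- One plus the distance of a row to the two rows next to the horizontal axis of height `z + 1/2`. -/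
def hgt (z y : ℤ) : ℕ := (if z < y then y - z else z + 1 - y).toNat

/-- The size of the displacement of a permutation. -/
noncomputable def area (z : ℤ) (π : Perm B) : ℕ :=
  ∑ b : B, if π b = b then 0 else hgt z b.1.2

/-- Flip around a square. -/
theorem flip_square (z : ℤ) (O : Set (ℤ × ℤ)) (π : Perm B) (hπ : ∀ b, Arc z O b.1 (π b).1) {b c : B}
    (hbc : b ≠ c) (hpb : π b = c)
    (h1 : Arc z O b.1 (π c).1) (h2 : wt b.1 (π c).1 = - (wt b.1 c.1 * wt c.1 (π c).1)) :
    ∃ π' : Perm B, (∀ b, Arc z O b.1 (π' b).1) ∧ ksign π' = ksign π ∧ area z π' < area z π := by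
  have hpc : π c ≠ c := fun h => hbc (π.injective (hpb.trans h.symm))
  refine ⟨π * swap b c, fun a => ?_, ?_, ?_⟩
  · rcases eq_or_ne a b with rfl | hab
    · simpa using h1
    rcases eq_or_ne a c with rfl | hac
    · simp [hpb, Arc.rfl']
    · rw [Perm.mul_apply, swap_apply_of_ne_of_ne hab hac]; exact hπ a
  · have := prod_mul_swap (fun a b : B => wt a.1 b.1) π hbc
    simp only [hpb] at this
    rw [wt_self, h2, mul_one] at this
    have h3 : ∏ a : B, wt a.1 ((π * swap b c) a).1 = - ∏ a : B, wt a.1 (π a).1 := by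
      refine mul_right_cancel (b := wt b.1 c.1 * wt c.1 (π c).1) ?_
      rw [this]; simp
    simp only [ksign, h3, Perm.sign_mul, Perm.sign_swap hbc]
    simp
  · have := sum_mul_swap (fun a b : B => if b = a then 0 else hgt z a.1.2) π hbc
    simp only [hpb, if_neg hbc.symm, if_neg hpc, if_true] at this
    have hpos : 0 < hgt z c.1.2 := by unfold hgt; split_ifs <;> omega
    have hle : (if π c = b then 0 else hgt z b.1.2) ≤ hgt z b.1.2 := by split_ifs <;> omega
    unfold area
    omega

/-- Flip around a hexagon: `b → c → f`, `e → e` is replaced by `b → e → f`, `c → c`. -/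
theorem flip_hexagon (z : ℤ) (O : Set (ℤ × ℤ)) (π : Perm B) (hπ : ∀ b, Arc z O b.1 (π b).1)
    {b c e : B} (hbc : b ≠ c) (hpb : π b = c) (hpe : π e = e) (hbe : b ≠ e)
    (hce : c ≠ e) (h1 : Arc z O b.1 e.1) (h2 : Arc z O e.1 (π c).1)
    (h3 : wt b.1 e.1 * wt e.1 (π c).1 = wt b.1 c.1 * wt c.1 (π c).1)
    (h4 : hgt z e.1.2 < hgt z c.1.2) :
    ∃ π' : Perm B, (∀ b, Arc z O b.1 (π' b).1) ∧ ksign π' = ksign π ∧ area z π' < area z π := by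
  have hpc : π c ≠ c := fun h => hbc (π.injective (hpb.trans h.symm))
  have hpce : π c ≠ e := fun h => hce (π.injective (h.trans hpe.symm))
  refine ⟨π * swap b c * swap b e, fun a => ?_, ?_, ?_⟩
  · rcases eq_or_ne a b with rfl | hab
    · simpa [swap_apply_of_ne_of_ne hbe.symm hce.symm, hpe] using h1
    rcases eq_or_ne a e with rfl | hae
    · simpa using h2
    rcases eq_or_ne a c with rfl | hac
    · simp [hpb, Arc.rfl', swap_apply_of_ne_of_ne hbc.symm hce]
    · rw [Perm.mul_apply, Perm.mul_apply, swap_apply_of_ne_of_ne hab hae,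
        swap_apply_of_ne_of_ne hab hac]; exact hπ a
  · have := prod_mul_cycle (fun a b : B => wt a.1 b.1) π hbc hbe hce
    simp only [hpb, hpe, h3, wt_self, mul_one] at this
    have h5 := mul_right_cancel this
    simp only [ksign, h5, Perm.sign_mul, Perm.sign_swap hbc, Perm.sign_swap hbe]
    simp
  · have := sum_mul_cycle (fun a b : B => if b = a then 0 else hgt z a.1.2) π hbc hbe hce
    simp only [hpb, hpe, if_neg hbc.symm, if_neg hbe.symm, if_neg hpc, if_neg hpce, if_true] at this
    unfold area
    omega

/-- Flip around a hexagon crossing the axis: `a → b → c → f` is replaced by `a → f`, `b → b`,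
`c → c`. -/
theorem flip_central (z : ℤ) (O : Set (ℤ × ℤ)) (π : Perm B) (hπ : ∀ b, Arc z O b.1 (π b).1)
    {a b c : B} (hab : a ≠ b) (hbc : b ≠ c) (hac : a ≠ c) (hpa : π a = b) (hpb : π b = c)
    (h1 : Arc z O a.1 (π c).1)
    (h3 : wt a.1 (π c).1 = wt a.1 b.1 * wt b.1 c.1 * wt c.1 (π c).1) :
    ∃ π' : Perm B, (∀ b, Arc z O b.1 (π' b).1) ∧ ksign π' = ksign π ∧ area z π' < area z π := by
  have hpc : π c ≠ c := fun h => hbc (π.injective (hpb.trans h.symm))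
  refine ⟨π * swap a b * swap a c, fun d => ?_, ?_, ?_⟩
  · rcases eq_or_ne d a with rfl | had
    · simpa [swap_apply_of_ne_of_ne hac.symm hbc.symm] using h1
    rcases eq_or_ne d c with rfl | hdc
    · simp [hpb, Arc.rfl']
    rcases eq_or_ne d b with rfl | hdb
    · simp [hpa, Arc.rfl', swap_apply_of_ne_of_ne hab.symm hbc]
    · rw [Perm.mul_apply, Perm.mul_apply, swap_apply_of_ne_of_ne had hdc,
        swap_apply_of_ne_of_ne had hdb]; exact hπ d
  · have := prod_mul_cycle (fun a b : B => wt a.1 b.1) π hab hac hbc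
    simp only [hpa, hpb, h3, wt_self, mul_one] at this
    have h5 := mul_right_cancel this
    simp only [ksign, h5, Perm.sign_mul, Perm.sign_swap hab, Perm.sign_swap hac]
    simp
  · have := sum_mul_cycle (fun a b : B => if b = a then 0 else hgt z a.1.2) π hab hac hbc
    simp only [hpa, hpb, if_neg hab.symm, if_neg hbc.symm, if_neg hpc, if_true] at this
    have hpos : 0 < hgt z c.1.2 := by unfold hgt; split_ifs <;> omega
    have hle : (if π c = a then 0 else hgt z a.1.2) ≤ hgt z a.1.2 := by split_ifs <;> omega
    unfold area
    omega

theorem eq_one_of_no_up {z : ℤ} {O : Set (ℤ × ℤ)} {π : Perm B} (hπ : ∀ b, Arc z O b.1 (π b).1)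
    (h : ∀ b, (π b).1.2 ≠ b.1.2 + 1) : π = 1 := by
  have h1 : ∀ b ∈ (Finset.univ : Finset B), (π b).1.2 ≤ b.1.2 := by
    intro b _
    have := h b
    rcases hπ b with h | h | h <;> omega
  have h2 := (Finset.sum_eq_sum_iff_of_le h1).1 (Equiv.sum_comp π fun b => b.1.2)
  have h3 : ∀ b ∈ (Finset.univ : Finset B), eps z b.1.2 * b.1.1 ≤ eps z (π b).1.2 * (π b).1.1 := by
    intro b hb
    have := h2 b hb
    rcases hπ b with h | h | h
    · rw [← this]
      unfold eps at *
      split_ifs at * <;> omega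
    all_goals omega
  have h4 := (Finset.sum_eq_sum_iff_of_le h3).1
    (Equiv.sum_comp π fun b => eps z b.1.2 * b.1.1).symm
  ext1 b
  have h5 := h2 b (Finset.mem_univ _)
  have h6 := h4 b (Finset.mem_univ _)
  refine Subtype.ext (Prod.ext ?_ h5)
  rw [h5] at h6
  have : eps z b.1.2 ≠ 0 := by unfold eps; split_ifs <;> norm_num
  exact (mul_left_cancel₀ this h6).symm

theorem exists_flip {z : ℤ} {O : Set (ℤ × ℤ)}
    (hU : ∀ x y, z < y → (x, y) ∈ B → (x + 1, y + 1) ∈ B → (x + 3, y + 1) ∈ B → (x + 2, y) ∈ B)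
    (hL : ∀ x y, y < z → (x + 2, y) ∈ B → (x, y) ∈ B → (x - 1, y + 1) ∈ B → (x + 1, y + 1) ∈ B)
    {π : Perm B} (hπ : ∀ b, Arc z O b.1 (π b).1) (hne : π ≠ 1) :
    ∃ π' : Perm B, (∀ b, Arc z O b.1 (π' b).1) ∧ ksign π' = ksign π ∧ area z π' < area z π := by
  classical
  let ups : Finset B := Finset.univ.filter fun b => (π b).1.2 = b.1.2 + 1
  have mem_ups : ∀ b, b ∈ ups ↔ (π b).1.2 = b.1.2 + 1 := fun b => by simp [ups]
  have hups : ups.Nonempty := by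
    by_contra h
    refine hne (eq_one_of_no_up hπ fun b hb => h ⟨b, (mem_ups b).2 hb⟩)
  let τ : B → ℤ := fun b => b.1.1 - |b.1.2 - z|
  obtain ⟨b₀, hb₀, hmax⟩ := ups.exists_max_image τ hups
  have τ_def : ∀ b : B, (z ≤ b.1.2 ∧ τ b = b.1.1 - (b.1.2 - z)) ∨
      (b.1.2 ≤ z ∧ τ b = b.1.1 + (b.1.2 - z)) := by
    intro b
    rcases le_total z b.1.2 with h | h
    · left; exact ⟨h, by simp only [τ]; rw [abs_of_nonneg (by omega)]⟩
    · right; exact ⟨h, by simp only [τ]; rw [abs_of_nonpos (by omega)]; omega⟩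
  have pre : ∀ b, Arc z O (π.symm b).1 b.1 := fun b => by simpa using hπ (π.symm b)
  have ext' : ∀ {b c : B}, b.1.1 = c.1.1 → b.1.2 = c.1.2 → b = c :=
    fun h1 h2 => Subtype.ext (Prod.ext h1 h2)
  by_cases hA : ∃ b ∈ ups, τ b = τ b₀ ∧ z < b.1.2
  · obtain ⟨b, hb, hbmax⟩ := (ups.filter fun b => τ b = τ b₀ ∧ z < b.1.2).exists_max_image
      (fun b => b.1.2) (by obtain ⟨b, h1, h2⟩ := hA; exact ⟨b, Finset.mem_filter.2 ⟨h1, h2⟩⟩)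
    obtain ⟨hbu, hbτ, hbz⟩ := Finset.mem_filter.1 hb
    have hc2 := (mem_ups b).1 hbu
    have hc1 : (π b).1.1 = b.1.1 + 1 := by
      have := hπ b
      simp only [Arc, eps] at this
      split_ifs at this <;> omega
    obtain ⟨c, hc⟩ : ∃ c, c = π b := ⟨_, rfl⟩
    rw [← hc] at hc1 hc2
    have hbc : b ≠ c := by rintro rfl; omega
    have hpc : π c ≠ c := fun h => hbc (π.injective (hc.symm.trans h.symm))
    have τb := τ_def b
    have τc := τ_def c
    rcases hπ c with ⟨h2, h1 | h1⟩ | ⟨h2, h1⟩ | ⟨h2, h1, h3⟩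
    · exact absurd (ext' h1 h2) hpc
    · rw [eps, if_pos (by omega)] at h1
      have heB := hU b.1.1 b.1.2 hbz b.2
        (by have := c.2; rwa [show c.1 = (b.1.1 + 1, b.1.2 + 1) from Prod.ext hc1 hc2] at this)
        (by have := (π c).2
            rwa [show (π c).1 = (b.1.1 + 3, b.1.2 + 1) from
              Prod.ext (by simp; omega) (by simp; omega)] at this)
      obtain ⟨e, he⟩ : ∃ e : B, e = ⟨_, heB⟩ := ⟨_, rfl⟩
      have he1 : e.1.1 = b.1.1 + 2 := by rw [he]
      have he2 : e.1.2 = b.1.2 := by rw [he]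
      have hpe : π e = e := by
        obtain ⟨g, hg⟩ : ∃ g, g = π.symm e := ⟨_, rfl⟩
        have hg' : π g = e := by rw [hg]; simp
        have hpre := pre e
        rw [← hg] at hpre
        have τg := τ_def g
        simp only [Arc, eps, if_pos (show z < e.1.2 by omega)] at hpre
        rcases hpre with ⟨h4, h5 | h5⟩ | ⟨h4, h5⟩ | ⟨h4, h5, -⟩
        · have : e = g := ext' h5 h4
          rwa [← this] at hg'
        · have : g = b := ext' (by omega) (by omega)
          rw [this, ← hc] at hg'
          rw [hg'] at hc2; omega
        · have := hmax g ((mem_ups g).2 (by rw [hg', h4]))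
          omega
        · have : g = c := ext' (by omega) (by omega)
          rw [this] at hg'
          rw [hg'] at h2; omega
      refine flip_hexagon z O π hπ hbc hc.symm hpe (by rintro rfl; omega) (by rintro rfl; omega)
        (Or.inl ⟨he2, Or.inr ?_⟩) (Or.inr (Or.inl ⟨by omega, ?_⟩)) ?_ ?_
      · rw [eps, if_pos (by omega)]; omega
      · rw [eps, if_pos (by omega)]; omega
      · simp only [wt]
        rw [if_neg (by omega), if_neg (by omega), if_neg (by omega), if_neg (by omega)]
      · simp only [hgt]
        rw [if_pos (by omega), if_pos (by omega)]; omega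
    · have := hbmax c (Finset.mem_filter.2 ⟨(mem_ups c).2 h2, by omega, by omega⟩)
      omega
    · rw [eps, if_pos (by omega)] at h1
      refine flip_square z O π hπ hbc hc.symm (Or.inl ⟨by omega, Or.inr ?_⟩) ?_
      · rw [eps, if_pos (by omega)]; omega
      · simp only [wt]
        rw [if_neg (by omega), if_neg (by omega), if_pos (by omega)]; simp
  by_cases hB : ∃ b ∈ ups, τ b = τ b₀ ∧ b.1.2 < z
  · obtain ⟨b, hb, hbmin⟩ := (ups.filter fun b => τ b = τ b₀ ∧ b.1.2 < z).exists_min_image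
      (fun b => b.1.2) (by obtain ⟨b, h1, h2⟩ := hB; exact ⟨b, Finset.mem_filter.2 ⟨h1, h2⟩⟩)
    obtain ⟨hbu, hbτ, hbz⟩ := Finset.mem_filter.1 hb
    have hc2 := (mem_ups b).1 hbu
    have hc1 : (π b).1.1 = b.1.1 - 1 := by
      have := hπ b
      simp only [Arc, eps] at this
      split_ifs at this <;> omega
    obtain ⟨c, hc⟩ : ∃ c, c = π b := ⟨_, rfl⟩
    rw [← hc] at hc1 hc2
    obtain ⟨a, ha⟩ : ∃ a, a = π.symm b := ⟨_, rfl⟩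
    have hpa : π a = b := by rw [ha]; simp
    have hpre := pre b
    rw [← ha] at hpre
    have hbc : b ≠ c := by rintro rfl; omega
    have hab : a ≠ b := fun h => hbc (by rw [hc, ← h, hpa]; exact h)
    have τb := τ_def b
    have τa := τ_def a
    rcases hpre with ⟨h2, h1 | h1⟩ | ⟨h2, h1⟩ | ⟨h2, h1, h3⟩
    · exact absurd (ext' h1 h2).symm hab
    · rw [eps, if_neg (by omega)] at h1
      have heB := hL b.1.1 b.1.2 hbz
        (by have := a.2
            rwa [show a.1 = (b.1.1 + 2, b.1.2) from
              Prod.ext (by simp; omega) (by simp; omega)] at this) b.2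
        (by have := c.2; rwa [show c.1 = (b.1.1 - 1, b.1.2 + 1) from Prod.ext hc1 hc2] at this)
      obtain ⟨e, he⟩ : ∃ e : B, e = ⟨_, heB⟩ := ⟨_, rfl⟩
      have he1 : e.1.1 = b.1.1 + 1 := by rw [he]
      have he2 : e.1.2 = b.1.2 + 1 := by rw [he]
      have τe := τ_def e
      have hpe : π e = e := by
        obtain ⟨g, hg⟩ : ∃ g, g = π e := ⟨_, rfl⟩
        have harc := hπ e
        rw [← hg] at harc ⊢
        rcases harc with ⟨h4, h5 | h5⟩ | ⟨h4, h5⟩ | ⟨h4, h5, -⟩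
        · exact ext' h5 h4
        · rw [eps, if_neg (by omega)] at h5
          have : g = c := ext' (by omega) (by omega)
          have : e = b := π.injective (by rw [← hg, ← hc, this])
          rw [this] at he2; omega
        · have := hmax e ((mem_ups e).2 (by rw [← hg, h4]))
          omega
        · rw [eps, if_neg (by omega)] at h5
          have : g = b := ext' (by omega) (by omega)
          have : e = a := π.injective (by rw [← hg, hpa, this])
          rw [this] at he2; omega
      refine flip_hexagon z O π hπ hab hpa hpe (by rintro rfl; omega) (by rintro rfl; omega)
        (Or.inr (Or.inl ⟨by omega, ?_⟩)) (Or.inl ⟨?_, Or.inr ?_⟩) ?_ ?_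
      · rw [eps, if_neg (by omega)]; omega
      · rw [← hc]; omega
      · rw [← hc, eps, if_neg (by omega)]; omega
      · rw [← hc]
        simp only [wt]
        rw [if_neg (by omega), if_neg (by omega), if_neg (by omega), if_neg (by omega)]
      · simp only [hgt]
        rw [if_neg (by omega), if_neg (by omega)]; omega
    · have := hbmin a (Finset.mem_filter.2 ⟨(mem_ups a).2 (by rw [hpa, h2]), ?_, by omega⟩)
      · omega
      · rw [eps, if_neg (by omega)] at h1; omega
    · rw [eps, if_neg (by omega)] at h1
      refine flip_square z O π hπ hab hpa (Or.inl ⟨?_, Or.inr ?_⟩) ?_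
      · rw [← hc]; omega
      · rw [← hc, eps, if_neg (by omega)]; omega
      · rw [← hc]
        simp only [wt]
        rw [if_neg (by omega), if_pos (by omega), if_neg (by omega)]; simp
  · push Not at hA hB
    obtain ⟨b, hb⟩ : ∃ b, b = b₀ := ⟨_, rfl⟩
    rw [← hb] at hb₀ hmax hA hB
    have hb2 : b.1.2 = z := le_antisymm (hA b hb₀ rfl) (hB b hb₀ rfl)
    have hc2 := (mem_ups b).1 hb₀
    have hc1 : (π b).1.1 = b.1.1 + 1 := by
      have := hπ b
      simp only [Arc, eps] at this
      split_ifs at this <;> omega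
    obtain ⟨c, hc⟩ : ∃ c, c = π b := ⟨_, rfl⟩
    rw [← hc] at hc1 hc2
    have hbc : b ≠ c := by rintro rfl; omega
    have hpc : π c ≠ c := fun h => hbc (π.injective (hc.symm.trans h.symm))
    have τb := τ_def b
    have τc := τ_def c
    rcases hπ c with ⟨h2, h1 | h1⟩ | ⟨h2, h1⟩ | ⟨h2, h1, h3⟩
    · exact absurd (ext' h1 h2) hpc
    · rw [eps, if_pos (by omega)] at h1
      obtain ⟨a, ha⟩ : ∃ a, a = π.symm b := ⟨_, rfl⟩
      have hpa : π a = b := by rw [ha]; simp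
      have hpre := pre b
      rw [← ha] at hpre
      have τa := τ_def a
      simp only [Arc, eps, if_neg (show ¬ z < b.1.2 by omega)] at hpre
      rcases hpre with ⟨h4, h5 | h5⟩ | ⟨h4, h5⟩ | ⟨h4, h5, -⟩
      · have : b = a := ext' h5 h4
        rw [← this, ← hc] at hpa
        exact absurd hpa.symm hbc
      · refine flip_central z O π hπ (by rintro rfl; omega) hbc (by rintro rfl; omega) hpa hc.symm
          (Or.inr (Or.inl ⟨by omega, ?_⟩)) ?_
        · rw [eps, if_pos (by omega)]; omega
        · simp only [wt]
          rw [if_neg (by omega), if_neg (by omega), if_neg (by omega), if_neg (by omega)]; simp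
      · have := hB a ((mem_ups a).2 (by rw [hpa, h4])) (by omega)
        omega
      · have : a = c := ext' (by omega) (by omega)
        rw [this] at hpa
        rw [hpa] at h2; omega
    · have := hA c ((mem_ups c).2 h2) (by omega)
      omega
    · rw [eps, if_neg (by omega)] at h1
      have hcb : π c = b := ext' (by omega) (by omega)
      refine flip_square z O π hπ hbc hc.symm ?_ ?_
      · rw [hcb]; exact Arc.rfl' _
      · rw [hcb, wt_self]
        simp only [wt]
        rw [if_neg (by omega), if_pos (by omega)]; simp

/-- All permutations along arcs have the same total Kasteleyn sign. -/
theorem ksign_eq_one {z : ℤ} {O : Set (ℤ × ℤ)}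
    (hU : ∀ x y, z < y → (x, y) ∈ B → (x + 1, y + 1) ∈ B → (x + 3, y + 1) ∈ B → (x + 2, y) ∈ B)
    (hL : ∀ x y, y < z → (x + 2, y) ∈ B → (x, y) ∈ B → (x - 1, y + 1) ∈ B → (x + 1, y + 1) ∈ B)
    (π : Perm B) (hπ : ∀ b, Arc z O b.1 (π b).1) : ksign π = 1 := by
  induction hn : area z π using Nat.strong_induction_on generalizing π with
  | _ n ih =>
    by_cases h : π = 1
    · subst h; simp [ksign]
    · obtain ⟨π', h1, h2, h3⟩ := exists_flip hU hL hπ h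
      rw [← h2]
      exact ih _ (hn ▸ h3) π' h1 rfl

end sign

section kuo

variable {X : Type*} [Fintype X] [DecidableEq X]

theorem det_of_sign (R : X → X → Prop) (w : X → X → ℤˣ) (ε : ℤˣ) (N : Matrix X X ℚ)
    (h1 : ∀ b c, R b c → N c b = (w b c : ℤ)) (h0 : ∀ b c, ¬ R b c → N c b = 0)
    (h : ∀ π : Perm X, (∀ b, R b (π b)) → Perm.sign π * ∏ b, w b (π b) = ε) :
    N.det = ((ε : ℤ) : ℚ) * Nat.card {π : Perm X // ∀ b, R b (π b)} := by
  classical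
  rw [Matrix.det_apply]
  have : ∀ π : Perm X, Perm.sign π • ∏ b, N (π b) b =
      if ∀ b, R b (π b) then ((ε : ℤ) : ℚ) else 0 := by
    intro π
    split_ifs with hπ
    · rw [← h π hπ, Finset.prod_congr rfl fun b _ => h1 _ _ (hπ b)]
      push_cast
      simp [Units.smul_def]
    · push Not at hπ
      obtain ⟨b, hb⟩ := hπ
      have hz : ∏ b, N (π b) b = 0 := Finset.prod_eq_zero (Finset.mem_univ b) (h0 _ _ hb)
      rw [hz, smul_zero]
  rw [Finset.sum_congr rfl fun π _ => this π, ← Finset.sum_filter, Finset.sum_const,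
    Nat.card_eq_fintype_card, Fintype.card_subtype]
  simp [mul_comm]

/-- The determinant of a rank two perturbation of an invertible matrix. -/
theorem det_add_two_singles (K : Matrix X X ℚ) (hK : K.det ≠ 0) (A D C B : X) (s t : ℚ) :
    K.det * (K + Matrix.single A D s + Matrix.single C B t).det =
      (K.det + s * K.adjugate D A) * (K.det + t * K.adjugate B C) -
        s * t * K.adjugate D C * K.adjugate B A := by
  have hu : IsUnit K.det := isUnit_iff_ne_zero.2 hK
  let P : Matrix X (Fin 2) ℚ := Matrix.of fun x r => if r = 0 then (if x = A then s else 0) else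
    (if x = C then t else 0)
  let Q : Matrix (Fin 2) X ℚ := Matrix.of fun r x => if r = 0 then (if x = D then 1 else 0) else
    (if x = B then 1 else 0)
  have h1 : Matrix.single A D s + Matrix.single C B t = P * Q := by
    ext x y
    simp [P, Q, Matrix.mul_apply, Fin.sum_univ_two, Matrix.single_apply, ite_and, eq_comm]
    congr 1 <;> split_ifs <;> rfl
  have h2 : K + Matrix.single A D s + Matrix.single C B t = K * (1 + K⁻¹ * P * Q) := by
    rw [add_assoc, h1, Matrix.mul_add, mul_one, Matrix.mul_assoc, Matrix.mul_nonsing_inv_cancel_left _ _ hu]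
  have h3 : ∀ x y, K.adjugate x y = K.det * K⁻¹ x y := by
    intro x y
    rw [Matrix.inv_def, Matrix.smul_apply, smul_eq_mul, Ring.inverse_eq_inv', ← mul_assoc,
      mul_inv_cancel₀ hK, one_mul]
  have h4 : ∀ r q, (Q * (K⁻¹ * P)) r q = K⁻¹ (if r = 0 then D else B) (if q = 0 then A else C) *
      (if q = 0 then s else t) := by
    intro r q
    simp only [Matrix.mul_apply, P, Q, Matrix.of_apply]
    fin_cases r <;> fin_cases q <;> simp
  rw [h2, Matrix.det_mul, Matrix.det_one_add_mul_comm, Matrix.det_fin_two]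
  simp only [Matrix.add_apply, h4, h3]
  simp
  ring

/-- Kuo's condensation, for permutations along the arcs of a relation for which all permutations
have the same sign. -/
theorem kuo_condensation (R : X → X → Prop) (w : X → X → ℤˣ) (D A B C : X) (ε : ℤˣ)
    (hrefl : ∀ b, R b b) (hDA : R D A) (hBC : R B C) (nDA : D ≠ A) (nBC : B ≠ C) (nDB : D ≠ B)
    (wDA : w D A = 1) (wBC : w B C = -1)
    (hT : ∀ π : Perm X, (∀ b, R b (π b)) → Perm.sign π * ∏ b, w b (π b) = 1)
    (hN : ∀ π : Perm X, π B = A → (∀ b, b ≠ B → R b (π b)) →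
      Perm.sign π * ∏ b, (if b = B then 1 else w b (π b)) = ε)
    (hS : ∀ π : Perm X, π D = C → (∀ b, b ≠ D → R b (π b)) →
      Perm.sign π * ∏ b, (if b = D then 1 else w b (π b)) = ε) :
    Nat.card {π : Perm X // ∀ b, R b (π b)} *
        Nat.card {π : Perm X // (∀ b, R b (π b)) ∧ π D ≠ A ∧ π B ≠ C} =
      Nat.card {π : Perm X // (∀ b, R b (π b)) ∧ π D ≠ A} *
          Nat.card {π : Perm X // (∀ b, R b (π b)) ∧ π B ≠ C} +
        Nat.card {π : Perm X // π B = A ∧ ∀ b, b ≠ B → R b (π b)} *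
          Nat.card {π : Perm X // π D = C ∧ ∀ b, b ≠ D → R b (π b)} := by
  classical
  let M : (X → X → Prop) → Matrix X X ℚ := fun R =>
    Matrix.of fun c b => if R b c then ((w b c : ℤ) : ℚ) else 0
  let K := M fun b c => R b c ∧ ¬ (b = D ∧ c = A) ∧ ¬ (b = B ∧ c = C)
  have main : ∀ R' : X → X → Prop, (∀ b c, R' b c → R b c) →
      (M R').det = Nat.card {π : Perm X // ∀ b, R' b (π b)} := by
    intro R' h
    rw [det_of_sign R' w 1 (M R') (fun b c h => if_pos h) (fun b c h => if_neg h)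
      fun π hπ => hT π fun b => h _ _ (hπ b)]
    simp
  have hE : M (fun b c => R b c ∧ ¬ (b = D ∧ c = A)) =
      K + Matrix.single A D 0 + Matrix.single C B (-1) := by
    ext c b
    by_cases h : b = B ∧ c = C
    · obtain ⟨rfl, rfl⟩ := h
      simp [K, M, hBC, nDB.symm, wBC]
    · have h' : ¬ (C = c ∧ B = b) := fun h' => h ⟨h'.2.symm, h'.1.symm⟩
      have h3 : b = B → c ≠ C := fun h1 h2 => h ⟨h1, h2⟩
      simp [K, M, h', and_iff_left h3]
  have hW : M (fun b c => R b c ∧ ¬ (b = B ∧ c = C)) =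
      K + Matrix.single A D 1 + Matrix.single C B 0 := by
    ext c b
    by_cases h : b = D ∧ c = A
    · obtain ⟨rfl, rfl⟩ := h
      simp [K, M, hDA, nDB, wDA]
    · have h' : ¬ (A = c ∧ D = b) := fun h' => h ⟨h'.2.symm, h'.1.symm⟩
      have h3 : b = D → c ≠ A := fun h1 h2 => h ⟨h1, h2⟩
      simp [K, M, h', and_iff_right h3]
  have hTT : M R = K + Matrix.single A D 1 + Matrix.single C B (-1) := by
    ext c b
    by_cases h : b = D ∧ c = A
    · obtain ⟨rfl, rfl⟩ := h
      have : ¬ (C = c ∧ B = b) := fun h => nDB h.2.symm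
      simp [K, M, hDA, nDB, wDA, this]
    · have h' : ¬ (A = c ∧ D = b) := fun h' => h ⟨h'.2.symm, h'.1.symm⟩
      by_cases h2 : b = B ∧ c = C
      · obtain ⟨rfl, rfl⟩ := h2
        simp [K, M, hBC, nDB.symm, wBC, h']
      · have h2' : ¬ (C = c ∧ B = b) := fun h' => h2 ⟨h'.2.symm, h'.1.symm⟩
        have h3 : b = D → c ≠ A := fun h1 h2 => h ⟨h1, h2⟩
        have h4 : b = B → c ≠ C := fun h1 h3 => h2 ⟨h1, h3⟩
        simp [K, M, h', h2', and_iff_left h3, and_iff_left h4]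
  have key : ∀ (P Q : X) (hPQ : ∀ π : Perm X, π P = Q → (∀ b, b ≠ P → R b (π b)) →
      Perm.sign π * ∏ b, (if b = P then 1 else w b (π b)) = ε)
      (hex : (P = B ∧ Q = A) ∨ (P = D ∧ Q = C)), K.adjugate P Q = ((ε : ℤ) : ℚ) *
        Nat.card {π : Perm X // π P = Q ∧ ∀ b, b ≠ P → R b (π b)} := by
    intro P Q hPQ hex
    rw [Matrix.adjugate_apply]
    have hiff : ∀ π : Perm X, (∀ b, (b = P ∧ π b = Q) ∨ (π b ≠ Q ∧ R b (π b) ∧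
        ¬ (b = D ∧ π b = A) ∧ ¬ (b = B ∧ π b = C))) ↔ π P = Q ∧ ∀ b, b ≠ P → R b (π b) := by
      intro π
      constructor
      · intro h
        refine ⟨?_, fun b hb => ?_⟩
        · rcases h (π.symm Q) with h | h
          · rw [← h.1]; simp
          · simp at h
        · rcases h b with h | h
          · exact absurd h.1 hb
          · exact h.2.1
      · rintro ⟨h1, h2⟩ b
        by_cases hb : b = P
        · exact Or.inl ⟨hb, hb ▸ h1⟩
        · have h3 : π b ≠ Q := fun h => hb (π.injective (h.trans h1.symm))
          refine Or.inr ⟨h3, h2 b hb, ?_, ?_⟩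
          · rintro ⟨h4, h5⟩
            rcases hex with ⟨h6, h7⟩ | ⟨h6, h7⟩
            · exact h3 (h5.trans h7.symm)
            · exact hb (h4.trans h6.symm)
          · rintro ⟨h4, h5⟩
            rcases hex with ⟨h6, h7⟩ | ⟨h6, h7⟩
            · exact hb (h4.trans h6.symm)
            · exact h3 (h5.trans h7.symm)
    rw [det_of_sign (fun b c => (b = P ∧ c = Q) ∨ (c ≠ Q ∧ R b c ∧
        ¬ (b = D ∧ c = A) ∧ ¬ (b = B ∧ c = C))) (fun b c => if b = P ∧ c = Q then 1 else w b c) ε]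
    · congr 2
      exact Nat.card_congr (Equiv.subtypeEquivRight hiff)
    · rintro b c (⟨rfl, rfl⟩ | ⟨h1, h2⟩)
      · simp
      · rw [Matrix.updateRow_ne h1, if_neg (fun h => h1 h.2)]
        exact if_pos h2
    · intro b c h
      push Not at h
      by_cases hc : c = Q
      · rw [hc, Matrix.updateRow_self, Pi.single_apply, if_neg fun h' => h.1 h' hc]
      · rw [Matrix.updateRow_ne hc]
        refine if_neg fun h' => ?_
        exact h'.2.2 (h.2 hc h'.1 fun h1 h2 => h'.2.1 ⟨h1, h2⟩)
    · intro π hπ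
      obtain ⟨h1, h2⟩ := (hiff π).1 hπ
      rw [← hPQ π h1 h2]
      congr 1
      refine Finset.prod_congr rfl fun b _ => ?_
      by_cases hb : b = P
      · subst hb; simp [h1]
      · simp [hb]
  have cardC : K.det = Nat.card {π : Perm X // (∀ b, R b (π b)) ∧ π D ≠ A ∧ π B ≠ C} := by
    rw [main _ fun b c h => h.1]
    congr 1
    refine Nat.card_congr (Equiv.subtypeEquivRight fun π => ?_)
    refine ⟨fun h => ⟨fun b => (h b).1, fun h' => (h D).2.1 ⟨rfl, h'⟩, fun h' => (h B).2.2 ⟨rfl, h'⟩⟩,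
      fun h b => ⟨h.1 b, ?_, ?_⟩⟩
    · rintro ⟨rfl, h'⟩; exact h.2.1 h'
    · rintro ⟨rfl, h'⟩; exact h.2.2 h'
  have cardE : (M (fun b c => R b c ∧ ¬ (b = D ∧ c = A))).det =
      Nat.card {π : Perm X // (∀ b, R b (π b)) ∧ π D ≠ A} := by
    rw [main _ fun b c h => h.1]
    congr 1
    refine Nat.card_congr (Equiv.subtypeEquivRight fun π => ?_)
    refine ⟨fun h => ⟨fun b => (h b).1, fun h' => (h D).2 ⟨rfl, h'⟩⟩, fun h b => ⟨h.1 b, ?_⟩⟩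
    rintro ⟨rfl, h'⟩; exact h.2 h'
  have cardW : (M (fun b c => R b c ∧ ¬ (b = B ∧ c = C))).det =
      Nat.card {π : Perm X // (∀ b, R b (π b)) ∧ π B ≠ C} := by
    rw [main _ fun b c h => h.1]
    congr 1
    refine Nat.card_congr (Equiv.subtypeEquivRight fun π => ?_)
    refine ⟨fun h => ⟨fun b => (h b).1, fun h' => (h B).2 ⟨rfl, h'⟩⟩, fun h b => ⟨h.1 b, ?_⟩⟩
    rintro ⟨rfl, h'⟩; exact h.2 h'
  have hK : K.det ≠ 0 := by
    rw [cardC]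
    have : Nonempty {π : Perm X // (∀ b, R b (π b)) ∧ π D ≠ A ∧ π B ≠ C} :=
      ⟨⟨1, fun b => hrefl b, nDA, nBC⟩⟩
    exact_mod_cast Nat.card_pos.ne'
  have t1 := det_add_two_singles K hK A D C B 1 (-1)
  have t2 := det_add_two_singles K hK A D C B 0 (-1)
  have t3 := det_add_two_singles K hK A D C B 1 0
  rw [← hTT, main R fun _ _ h => h] at t1
  rw [← hE, cardE] at t2
  rw [← hW, cardW] at t3
  rw [key B A hN (Or.inl ⟨rfl, rfl⟩), key D C hS (Or.inr ⟨rfl, rfl⟩)] at t1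
  have hε : ((ε : ℤ) : ℚ) * ((ε : ℤ) : ℚ) = 1 := by
    rw [← Int.cast_mul, ← Units.val_mul, Int.units_mul_self]; simp
  rw [← Nat.cast_inj (R := ℚ)]
  push_cast
  rw [← cardC]
  generalize K.det = κ at *
  generalize K.adjugate D A = u at *
  generalize K.adjugate B C = v at *
  generalize (Nat.card {π : Perm X // (∀ b, R b (π b)) ∧ π D ≠ A} : ℚ) = e at *
  generalize (Nat.card {π : Perm X // (∀ b, R b (π b)) ∧ π B ≠ C} : ℚ) = f at *
  have he : e = κ - v := mul_left_cancel₀ hK (by linear_combination t2)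
  have hf : f = κ + u := mul_left_cancel₀ hK (by linear_combination t3)
  rw [he, hf]
  linear_combination t1 +
    (Nat.card {π : Perm X // π D = C ∧ ∀ b, b ≠ D → R b (π b)} : ℚ) *
      (Nat.card {π : Perm X // π B = A ∧ ∀ b, b ≠ B → R b (π b)} : ℚ) * hε

end kuo

/-- The permutations of `ℤ × ℤ` that fix the complement of `B` and move all points along arcs. -/
def Conf (z : ℤ) (O B : Set (ℤ × ℤ)) : Set (Perm (ℤ × ℤ)) :=
  {π | (∀ b, b ∉ B → π b = b) ∧ ∀ b, Arc z O b (π b)}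

theorem card_perm_subtype {α : Type*} (B : Set α) (P : Perm B → Prop) (Q : Perm α → Prop)
    (h : ∀ (π : Perm B) (π' : Perm α), (∀ b : B, π' b = π b) → (∀ b, b ∉ B → π' b = b) →
      (P π ↔ Q π')) :
    Nat.card {π : Perm B // P π} = {π : Perm α | (∀ b, b ∉ B → π b = b) ∧ Q π}.ncard := by
  classical
  rw [← Nat.card_coe_set_eq]
  refine Nat.card_congr (((Perm.subtypeEquivSubtypePerm (· ∈ B)).subtypeEquiv
    (q := fun π => Q π.1) fun π => ?_).trans (Equiv.subtypeSubtypeEquivSubtypeInter _ _))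
  exact h π _ (fun b => Perm.subtypeEquivSubtypePerm_apply_of_mem π b.2)
    (fun b hb => Perm.subtypeEquivSubtypePerm_apply_of_not_mem π hb)

theorem card_perm_conf (z : ℤ) (O B : Set (ℤ × ℤ)) (P : Perm B → Prop) (Q : Perm (ℤ × ℤ) → Prop)
    (h : ∀ (π : Perm B) (π' : Perm (ℤ × ℤ)), (∀ b : B, π' b = π b) → (P π ↔ Q π')) :
    Nat.card {π : Perm B // (∀ b, Arc z O b.1 (π b).1) ∧ P π} = {π ∈ Conf z O B | Q π}.ncard := by
  rw [card_perm_subtype B _ (fun π => (∀ b, Arc z O b (π b)) ∧ Q π)]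
  · simp only [Conf, Set.mem_ofPred_eq, and_assoc]
  · intro π π' h1 h2
    rw [h π π' h1]
    refine and_congr_left fun _ => ⟨fun h3 b => ?_, fun h3 b => ?_⟩
    · by_cases hb : b ∈ B
      · rw [h1 ⟨b, hb⟩]; exact h3 ⟨b, hb⟩
      · rw [h2 b hb]; exact Arc.rfl' b
    · rw [← h1 b]; exact h3 b

section twist

variable {B : Set (ℤ × ℤ)} {z : ℤ} {O : Set (ℤ × ℤ)} {θ : Perm B} {P Q : B}

theorem twist_iff (hPQ : θ P = Q)
    (h : ∀ (b : ℤ × ℤ) (c : B), c ≠ P → (Arc 0 O b (θ c).1 ↔ Arc z O b c.1)) (π : Perm B) :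
    ((θ * π) P = Q ∧ ∀ b, b ≠ P → Arc 0 O b.1 ((θ * π) b).1) ↔
      (∀ b, Arc z O b.1 (π b).1) ∧ π P = P := by
  have h1 : (θ * π) P = Q ↔ π P = P := by rw [Perm.mul_apply, ← hPQ]; exact θ.injective.eq_iff
  rw [h1]
  refine ⟨fun ⟨h2, h3⟩ => ⟨fun b => ?_, h2⟩, fun ⟨h3, h2⟩ => ⟨h2, fun b hb => ?_⟩⟩
  · by_cases hb : b = P
    · rw [hb, h2]; exact Arc.rfl' _
    · exact (h _ _ fun h4 => hb (π.injective (h4.trans h2.symm))).1 (h3 b hb)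
  · exact (h _ _ fun h4 => hb (π.injective (h4.trans h2.symm))).2 (h3 b)

theorem twist_card (hPQ : θ P = Q)
    (h : ∀ (b : ℤ × ℤ) (c : B), c ≠ P → (Arc 0 O b (θ c).1 ↔ Arc z O b c.1)) :
    Nat.card {π : Perm B // π P = Q ∧ ∀ b, b ≠ P → Arc 0 O b.1 (π b).1} =
      (Conf z O (B \ {P.1})).ncard := by
  rw [← Nat.card_congr ((Equiv.mulLeft θ).subtypeEquiv fun π => (twist_iff hPQ h π).symm),
    card_perm_conf z O B _ fun π => π P.1 = P.1]
  · congr 1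
    ext π
    simp only [Conf, Set.mem_ofPred_eq]
    constructor
    · rintro ⟨⟨h1, h2⟩, h3⟩
      refine ⟨fun b hb => ?_, h2⟩
      by_cases hbP : b = P.1
      · rw [hbP, h3]
      · exact h1 b fun hb' => hb ⟨hb', hbP⟩
    · rintro ⟨h1, h2⟩
      exact ⟨⟨fun b hb => h1 b fun hb' => hb hb'.1, h2⟩, h1 _ fun h => h.2 rfl⟩
  · intro π π' h1
    rw [h1 P, Subtype.coe_inj]

theorem twist_sign [Fintype B] (hPQ : θ P = Q)
    (h : ∀ (b : ℤ × ℤ) (c : B), c ≠ P → (Arc 0 O b (θ c).1 ↔ Arc z O b c.1))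
    (hrow : ∀ c, (θ c).1.2 = c.1.2)
    (hs : ∀ π : Perm B, (∀ b, Arc z O b.1 (π b).1) → ksign π = 1)
    (π : Perm B) (h1 : π P = Q) (h2 : ∀ b, b ≠ P → Arc 0 O b.1 (π b).1) :
    Perm.sign π * ∏ b : B, (if b = P then 1 else wt b.1 (π b).1) = Perm.sign θ := by
  obtain ⟨ρ, rfl⟩ : ∃ ρ, π = θ * ρ := ⟨θ⁻¹ * π, by simp⟩
  obtain ⟨h3, h4⟩ := (twist_iff hPQ h ρ).1 ⟨h1, h2⟩
  have h5 := hs ρ h3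
  rw [ksign] at h5
  rw [Perm.sign_mul, mul_assoc]
  have h6 : ∏ b : B, (if b = P then 1 else wt b.1 ((θ * ρ) b).1) = ∏ b : B, wt b.1 (ρ b).1 := by
    refine Finset.prod_congr rfl fun b _ => ?_
    by_cases hb : b = P
    · rw [if_pos hb, hb, h4, wt_self]
    · rw [if_neg hb]
      simp only [wt, Perm.mul_apply, hrow]
  rw [h6, h5, mul_one]

end twist

section kuo

variable {B : Set (ℤ × ℤ)} {w : ℤ}

/-- The cyclic shift to the right of the row of height `1`. -/
def shiftUp (h1 : ∀ x, (x, 1) ∈ B ↔ Odd x ∧ 1 ≤ x ∧ x ≤ w) (hw : Odd w) : Perm B where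
  toFun c := if hc : c.1.2 = 1 then
      (if hx : c.1.1 = w then ⟨(1, 1), by
          have := c.2
          rw [show c.1 = (c.1.1, 1) from Prod.ext rfl hc, h1] at this
          exact (h1 1).2 ⟨odd_one, le_rfl, by omega⟩⟩
        else ⟨(c.1.1 + 2, 1), by
          have := c.2
          rw [show c.1 = (c.1.1, 1) from Prod.ext rfl hc, h1] at this
          obtain ⟨⟨u, hu⟩, h2, h3⟩ := this
          obtain ⟨v, hv⟩ := hw
          exact (h1 _).2 ⟨⟨u + 1, by omega⟩, by omega, by omega⟩⟩)
    else c
  invFun c := if hc : c.1.2 = 1 then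
      (if hx : c.1.1 = 1 then ⟨(w, 1), by
          have := c.2
          rw [show c.1 = (c.1.1, 1) from Prod.ext rfl hc, h1] at this
          exact (h1 w).2 ⟨hw, by omega, by omega⟩⟩
        else ⟨(c.1.1 - 2, 1), by
          have := c.2
          rw [show c.1 = (c.1.1, 1) from Prod.ext rfl hc, h1] at this
          obtain ⟨⟨u, hu⟩, h2, h3⟩ := this
          obtain ⟨v, hv⟩ := hw
          exact (h1 _).2 ⟨⟨u - 1, by omega⟩, by omega, by omega⟩⟩)
    else c
  left_inv c := by
    by_cases hc : c.1.2 = 1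
    · have := c.2
      rw [show c.1 = (c.1.1, 1) from Prod.ext rfl hc, h1] at this
      by_cases hx : c.1.1 = w
      · simp only [hc, hx, dite_true]
        exact Subtype.ext (Prod.ext hx.symm hc.symm)
      · have h4 : ¬ c.1.1 + 2 = 1 := by omega
        simp only [hc, hx, h4, dite_true, dite_false]
        exact Subtype.ext (Prod.ext (by simp) hc.symm)
    · simp [hc]
  right_inv c := by
    by_cases hc : c.1.2 = 1
    · have := c.2
      rw [show c.1 = (c.1.1, 1) from Prod.ext rfl hc, h1] at this
      by_cases hx : c.1.1 = 1
      · simp only [hc, hx, dite_true]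
        exact Subtype.ext (Prod.ext hx.symm hc.symm)
      · have h4 : ¬ c.1.1 - 2 = w := by omega
        simp only [hc, hx, h4, dite_true, dite_false]
        exact Subtype.ext (Prod.ext (by simp) hc.symm)
    · simp [hc]

/-- The exchange of the rows of heights `0` and `1`. -/
def rowSwap (h1 : ∀ x, (x, 1) ∈ B ↔ Odd x ∧ 1 ≤ x ∧ x ≤ w)
    (h0 : ∀ x, (x, 0) ∈ B ↔ Even x ∧ 0 ≤ x ∧ x < w) : Perm B :=
  Function.Involutive.toPerm
    (fun c => if hc : c.1.2 = 1 then ⟨(c.1.1 - 1, 0), by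
        have := c.2
        rw [show c.1 = (c.1.1, 1) from Prod.ext rfl hc, h1] at this
        obtain ⟨⟨u, hu⟩, h2, h3⟩ := this
        exact (h0 _).2 ⟨⟨u, by omega⟩, by omega, by omega⟩⟩
      else if hc' : c.1.2 = 0 then ⟨(c.1.1 + 1, 1), by
        have := c.2
        rw [show c.1 = (c.1.1, 0) from Prod.ext rfl hc', h0] at this
        obtain ⟨⟨u, hu⟩, h2, h3⟩ := this
        exact (h1 _).2 ⟨⟨u, by omega⟩, by omega, by omega⟩⟩
      else c) (by
    intro c
    by_cases hc : c.1.2 = 1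
    · simp only [hc, dite_true]
      exact Subtype.ext (Prod.ext (by simp) (by simp [hc]))
    · by_cases hc' : c.1.2 = 0
      · simp only [hc', dite_true]
        exact Subtype.ext (Prod.ext (by simp) (by simp [hc']))
      · simp [hc, hc'])

theorem kuo_conf [Fintype B] {O : Set (ℤ × ℤ)}
    (h1 : ∀ x, (x, 1) ∈ B ↔ Odd x ∧ 1 ≤ x ∧ x ≤ w)
    (h0 : ∀ x, (x, 0) ∈ B ↔ Even x ∧ 0 ≤ x ∧ x < w) (hw : Odd w) (hw1 : 1 ≤ w) (hO : (w, 0) ∈ O)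
    (hU : ∀ x y, -1 < y → (x, y) ∈ B → (x + 1, y + 1) ∈ B → (x + 3, y + 1) ∈ B → (x + 2, y) ∈ B)
    (hL : ∀ x y, y < 1 → (x + 2, y) ∈ B → (x, y) ∈ B → (x - 1, y + 1) ∈ B → (x + 1, y + 1) ∈ B) :
    (Conf 0 O B).ncard * {π ∈ Conf 0 O B | π (0, 0) ≠ (1, 1) ∧ π (w, 1) ≠ (w - 1, 0)}.ncard =
      {π ∈ Conf 0 O B | π (0, 0) ≠ (1, 1)}.ncard *
          {π ∈ Conf 0 O B | π (w, 1) ≠ (w - 1, 0)}.ncard +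
        (Conf 1 O (B \ {(w, 1)})).ncard * (Conf (-1) O (B \ {(0, 0)})).ncard := by
  classical
  have hw' : Even (w - 1) := by obtain ⟨u, hu⟩ := hw; exact ⟨u, by omega⟩
  obtain ⟨D, hD⟩ : ∃ D : B, D.1 = (0, 0) := ⟨⟨_, (h0 0).2 ⟨by simp, le_rfl, by omega⟩⟩, rfl⟩
  obtain ⟨A, hA⟩ : ∃ A : B, A.1 = (1, 1) := ⟨⟨_, (h1 1).2 ⟨by simp, le_rfl, by omega⟩⟩, rfl⟩
  obtain ⟨E, hE⟩ : ∃ E : B, E.1 = (w, 1) := ⟨⟨_, (h1 w).2 ⟨hw, hw1, le_rfl⟩⟩, rfl⟩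
  obtain ⟨C, hC⟩ : ∃ C : B, C.1 = (w - 1, 0) := ⟨⟨_, (h0 _).2 ⟨hw', by omega, by omega⟩⟩, rfl⟩
  let χ := rowSwap h1 h0
  let θ := shiftUp h1 hw
  let θ' := χ * θ⁻¹ * χ⁻¹
  have hsign : Perm.sign θ' = Perm.sign θ := by
    simp only [θ', Perm.sign_mul, Perm.sign_inv]
    rw [mul_comm, ← mul_assoc, Int.units_mul_self, one_mul]
  have hθ1 : ∀ c : B, c.1.2 = 1 → c.1.1 = w → (θ c).1 = (1, 1) := by
    intro c hc hx; simp [θ, shiftUp, hc, hx]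
  have hθ2 : ∀ c : B, c.1.2 = 1 → c.1.1 ≠ w → (θ c).1 = (c.1.1 + 2, 1) := by
    intro c hc hx; simp [θ, shiftUp, hc, hx]
  have hθ3 : ∀ c : B, c.1.2 ≠ 1 → θ c = c := by
    intro c hc; simp [θ, shiftUp, hc]
  have hi1 : ∀ c : B, c.1.2 = 1 → c.1.1 = 1 → (θ⁻¹ c).1 = (w, 1) := by
    intro c hc hx; change (θ.symm c).1 = _; simp [θ, shiftUp, hc, hx]
  have hi2 : ∀ c : B, c.1.2 = 1 → c.1.1 ≠ 1 → (θ⁻¹ c).1 = (c.1.1 - 2, 1) := by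
    intro c hc hx; change (θ.symm c).1 = _; simp [θ, shiftUp, hc, hx]
  have hi3 : ∀ c : B, c.1.2 ≠ 1 → θ⁻¹ c = c := by
    intro c hc; change (θ.symm c) = _; simp [θ, shiftUp, hc]
  have hχ1 : ∀ c : B, c.1.2 = 1 → (χ c).1 = (c.1.1 - 1, 0) := by
    intro c hc; exact congrArg Subtype.val (dif_pos hc)
  have hχ0 : ∀ c : B, c.1.2 = 0 → (χ c).1 = (c.1.1 + 1, 1) := by
    intro c hc;  simp [χ, rowSwap, Function.Involutive.toPerm, hc]
  have hχ2 : ∀ c : B, c.1.2 ≠ 0 → c.1.2 ≠ 1 → χ c = c := by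
    intro c hc hc'; exact (dif_neg hc').trans (dif_neg hc)
  have hχi : ∀ c, χ⁻¹ c = χ c := fun c => rfl
  have hθ'1 : ∀ c : B, c.1.2 = 0 → c.1.1 = 0 → (θ' c).1 = (w - 1, 0) := by
    intro c hc hx
    have e1 := hχ0 c hc
    have e2 := hi1 (χ c) (by rw [e1]) (by rw [e1, hx]; rfl)
    have e3 := hχ1 (θ⁻¹ (χ c)) (by rw [e2])
    rw [e2] at e3
    exact e3
  have hθ'2 : ∀ c : B, c.1.2 = 0 → c.1.1 ≠ 0 → (θ' c).1 = (c.1.1 - 2, 0) := by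
    intro c hc hx
    have e1 := hχ0 c hc
    have e2 := hi2 (χ c) (by rw [e1]) (by rw [e1]; simpa using hx)
    have e3 := hχ1 (θ⁻¹ (χ c)) (by rw [e2])
    rw [e2, e1] at e3
    exact e3.trans (Prod.ext (by simp; ring) rfl)
  have hθ'3 : ∀ c : B, c.1.2 ≠ 0 → θ' c = c := by
    intro c hc
    by_cases hc' : c.1.2 = 1
    · have e1 := hχ1 c hc'
      have e2 := hi3 (χ c) (by rw [e1]; simp)
      change χ (θ⁻¹ (χ c)) = c
      rw [e2]
      exact χ.symm_apply_apply c
    · change χ (θ⁻¹ (χ c)) = c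
      rw [hχ2 c hc hc', hi3 c hc', hχ2 c hc hc']
  have tN : ∀ (b : ℤ × ℤ) (c : B), c ≠ E → (Arc 0 O b (θ c).1 ↔ Arc 1 O b c.1) := by
    intro b c hc
    by_cases hc1 : c.1.2 = 1
    · rw [hθ2 c hc1 fun h => hc (Subtype.ext ((Prod.ext h hc1).trans hE.symm))]
      simp only [Arc, eps, hc1]
      norm_num
      grind
    · rw [hθ3 c hc1]
      have : eps 0 c.1.2 = eps 1 c.1.2 := by unfold eps; split_ifs <;> omega
      simp only [Arc, this]
  have tS : ∀ (b : ℤ × ℤ) (c : B), c ≠ D → (Arc 0 O b (θ' c).1 ↔ Arc (-1) O b c.1) := by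
    intro b c hc
    by_cases hc1 : c.1.2 = 0
    · rw [hθ'2 c hc1 fun h => hc (Subtype.ext ((Prod.ext h hc1).trans hD.symm))]
      simp only [Arc, eps, hc1]
      norm_num
      grind
    · rw [hθ'3 c hc1]
      have : eps 0 c.1.2 = eps (-1) c.1.2 := by unfold eps; split_ifs <;> omega
      simp only [Arc, this]
  have hEA : θ E = A := Subtype.ext ((hθ1 E (by rw [hE]) (by rw [hE])).trans hA.symm)
  have hDC : θ' D = C := Subtype.ext ((hθ'1 D (by rw [hD]) (by rw [hD])).trans hC.symm)
  have sgn : ∀ z : ℤ, -1 ≤ z → z ≤ 1 → ∀ π : Perm B, (∀ b, Arc z O b.1 (π b).1) → ksign π = 1 :=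
    fun z hz hz' => ksign_eq_one (fun x y hy => hU x y (by omega)) (fun x y hy => hL x y (by omega))
  have key := kuo_condensation (fun b c : B => Arc 0 O b.1 c.1) (fun b c => wt b.1 c.1) D A E C
    (Perm.sign θ) (fun b => Arc.rfl' b.1)
    (by rw [hD, hA]; exact Or.inr (Or.inl ⟨rfl, rfl⟩))
    (by rw [hE, hC]; exact Or.inr (Or.inr ⟨rfl, by simp [eps]; ring, hO⟩))
    (by rw [Ne, ← Subtype.coe_inj, hD, hA]; simp)
    (by rw [Ne, ← Subtype.coe_inj, hE, hC]; simp)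
    (by rw [Ne, ← Subtype.coe_inj, hD, hE]; simp)
    (by rw [hD, hA]; simp [wt]) (by rw [hE, hC]; simp [wt])
    (sgn 0 (by omega) (by omega))
    (twist_sign hEA tN (fun c => by
      by_cases hc : c.1.2 = 1
      · by_cases hx : c.1.1 = w
        · rw [hθ1 c hc hx, hc]
        · rw [hθ2 c hc hx, hc]
      · rw [hθ3 c hc]) (sgn 1 (by omega) le_rfl))
    (hsign ▸ twist_sign hDC tS (fun c => by
      by_cases hc : c.1.2 = 0
      · by_cases hx : c.1.1 = 0
        · rw [hθ'1 c hc hx, hc]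
        · rw [hθ'2 c hc hx, hc]
      · rw [hθ'3 c hc]) (sgn (-1) le_rfl (by omega)))
  rw [twist_card hEA tN, twist_card hDC tS, hE, hD] at key
  have v1 : ∀ (π : Perm B) (π' : Perm (ℤ × ℤ)), (∀ b : B, π' b = π b) →
      (π D ≠ A ↔ π' (0, 0) ≠ (1, 1)) := by
    intro π π' h
    rw [← hD, ← hA, h D, Ne, Ne, Subtype.coe_inj]
  have v2 : ∀ (π : Perm B) (π' : Perm (ℤ × ℤ)), (∀ b : B, π' b = π b) →
      (π E ≠ C ↔ π' (w, 1) ≠ (w - 1, 0)) := by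
    intro π π' h
    rw [← hE, ← hC, h E, Ne, Ne, Subtype.coe_inj]
  rw [card_perm_conf 0 O B _ _ v1, card_perm_conf 0 O B _ _ v2,
    card_perm_conf 0 O B _ _ fun π π' h => and_congr (v1 π π' h) (v2 π π' h)] at key
  have hTrue := card_perm_conf 0 O B (fun _ => True) (fun _ => True) fun _ _ _ => Iff.rfl
  simp only [and_true] at hTrue
  rwa [hTrue] at key

end kuo

theorem ncard_eq_of_equiv {α : Type*} {S T : Set α} (F : α ≃ α) (h : ∀ π, π ∈ S ↔ F π ∈ T) :
    S.ncard = T.ncard := by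
  rw [← Nat.card_coe_set_eq, ← Nat.card_coe_set_eq]
  exact Nat.card_congr (F.subtypeEquiv h)

theorem conf_mem {z : ℤ} {O B : Set (ℤ × ℤ)} {π : Perm (ℤ × ℤ)} (h : π ∈ Conf z O B) {b : ℤ × ℤ}
    (hb : π b ≠ b) : b ∈ B ∧ π b ∈ B := by
  refine ⟨by_contra fun h' => hb (h.1 b h'), by_contra fun h' => hb (π.injective (h.1 _ h'))⟩

theorem sep_conf_eq {z : ℤ} {O O' B B' : Set (ℤ × ℤ)} (Q : Perm (ℤ × ℤ) → Prop) (hB : B' ⊆ B)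
    (h1 : ∀ π ∈ Conf z O B, Q π → ∀ b ∈ B, b ∉ B' → π b = b) (h2 : ∀ π ∈ Conf z O' B', Q π)
    (h3 : ∀ b ∈ B', ∀ c ∈ B', c.2 = b.2 - 1 → c.1 = b.1 + eps z c.2 →
      ((b.1, b.2 - 1) ∈ O ↔ (b.1, b.2 - 1) ∈ O')) :
    {π ∈ Conf z O B | Q π} = Conf z O' B' := by
  have key : ∀ π : Perm (ℤ × ℤ), (∀ b, b ∉ B' → π b = b) →
      ∀ b, Arc z O b (π b) ↔ Arc z O' b (π b) := by
    intro π h b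
    by_cases hb : π b = b
    · rw [hb]; exact iff_of_true (Arc.rfl' b) (Arc.rfl' b)
    · have hb1 : b ∈ B' := by_contra fun h' => hb (h b h')
      have hb2 : π b ∈ B' := by_contra fun h' => hb (π.injective (h _ h'))
      refine or_congr_right (or_congr_right (and_congr_right fun h4 => and_congr_right fun h5 => ?_))
      exact h3 b hb1 _ hb2 h4 h5
  ext π
  constructor
  · rintro ⟨h4, h5⟩
    have h6 : ∀ b, b ∉ B' → π b = b := by
      intro b hb
      by_cases hb' : b ∈ B
      · exact h1 π h4 h5 b hb' hb
      · exact h4.1 b hb'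
    exact ⟨h6, fun b => (key π h6 b).1 (h4.2 b)⟩
  · intro h4
    exact ⟨⟨fun b hb => h4.1 b fun h => hb (hB h), fun b => (key π h4.1 b).2 (h4.2 b)⟩, h2 π h4⟩

theorem fixed_of_forward {α : Type*} (π : Perm α) {X : Set α} (hX : X.Finite) (f : α → ℤ)
    (h : ∀ b ∈ X, π b ≠ b → π b ∈ X ∧ f b < f (π b)) : ∀ b ∈ X, π b = b := by
  by_contra! hne
  obtain ⟨b, hb, hmax⟩ := Set.exists_max_image {b ∈ X | π b ≠ b} f (hX.subset fun b hb => hb.1) hne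
  obtain ⟨h1, h2⟩ := h b hb.1 hb.2
  exact absurd (hmax (π b) ⟨h1, fun h3 => hb.2 (π.injective h3)⟩) (not_le.2 h2)

theorem fixed_of_backward {α : Type*} (π : Perm α) {X : Set α} (hX : X.Finite) (f : α → ℤ)
    (h : ∀ b, π b ∈ X → π b ≠ b → b ∈ X ∧ f (π b) < f b) : ∀ b ∈ X, π b = b := by
  intro b hb
  have := fixed_of_forward π⁻¹ hX f (fun b hb hne => by
    have h1 := h (π⁻¹ b) (by simpa using hb)
    rw [show π (π⁻¹ b) = b from π.apply_symm_apply b] at h1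
    exact h1 hne.symm) b hb
  exact (Perm.inv_eq_iff_eq.1 this).symm

section translate

variable {z : ℤ} {O B : Set (ℤ × ℤ)} (v : ℤ × ℤ)

theorem conj_mem_conf (π : Perm (ℤ × ℤ)) :
    π ∈ Conf z O B ↔ MulAut.conj (Equiv.addRight v) π ∈
      Conf (z + v.2) {p | p - v ∈ O} {p | p - v ∈ B} := by
  have h1 : ∀ b, MulAut.conj (Equiv.addRight v) π b = π (b - v) + v := by
    intro b
    rw [MulAut.conj_apply, Perm.mul_apply, Perm.mul_apply]
    simp [sub_eq_add_neg]
  have h2 : ∀ b c, Arc (z + v.2) {p | p - v ∈ O} (b + v) (c + v) ↔ Arc z O b c := by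
    intro b c
    have : eps (z + v.2) (c.2 + v.2) = eps z c.2 := by unfold eps; split_ifs <;> omega
    have h' : ((b.1 + v.1, b.2 + v.2 - 1) : ℤ × ℤ) - v = (b.1, b.2 - 1) :=
      Prod.ext (by simp) (by simp; ring)
    simp only [Arc, Prod.fst_add, Prod.snd_add, this, Set.mem_ofPred_eq, h']
    refine or_congr (and_congr ?_ (or_congr ?_ ?_)) (or_congr (and_congr ?_ ?_)
      (and_congr ?_ (and_congr ?_ Iff.rfl))) <;> constructor <;> intro h <;> omega
  simp only [Conf, Set.mem_ofPred_eq, h1]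
  refine and_congr ⟨fun h b hb => by rw [h _ hb]; simp, fun h b hb => ?_⟩
    ⟨fun h b => ?_, fun h b => ?_⟩
  · simpa using h (b + v) (by simpa using hb)
  · have := (h2 _ _).2 (h (b - v))
    rwa [sub_add_cancel] at this
  · have := h (b + v)
    rw [h2] at this
    simpa using this

theorem ncard_conf_translate :
    (Conf (z + v.2) {p | p - v ∈ O} {p | p - v ∈ B}).ncard = (Conf z O B).ncard :=
  (ncard_eq_of_equiv _ (conj_mem_conf v)).symm

theorem ncard_sep_conf_translate (p q : ℤ × ℤ) :
    {π ∈ Conf (z + v.2) {p | p - v ∈ O} {p | p - v ∈ B} | π (p + v) ≠ q + v}.ncard =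
      {π ∈ Conf z O B | π p ≠ q}.ncard := by
  refine (ncard_eq_of_equiv (MulAut.conj (Equiv.addRight v)).toEquiv fun π => ?_).symm
  refine and_congr (conj_mem_conf v π) (not_congr ?_)
  change _ ↔ (MulAut.conj (Equiv.addRight v) π) (p + v) = q + v
  rw [MulAut.conj_apply, Perm.mul_apply, Perm.mul_apply]
  simp

end translate

/-- The reflection exchanging the heights `y` and `1 - y`, transported to the vertices of even
coordinate sum through the pairing in the definition of `Arc`. -/
def reflect (z : ℤ) : (ℤ × ℤ) ≃ (ℤ × ℤ) where
  toFun p := (p.1 - eps z p.2, 1 - p.2)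
  invFun p := (p.1 - eps (-z) p.2, 1 - p.2)
  left_inv p := by
    refine Prod.ext ?_ ?_ <;> simp only [eps]
    · split_ifs <;> omega
    · omega
  right_inv p := by
    refine Prod.ext ?_ ?_ <;> simp only [eps]
    · split_ifs <;> omega
    · omega

theorem ncard_conf_reflect {z : ℤ} {O B : Set (ℤ × ℤ)} :
    (Conf (-z) {p | (p.1, -p.2) ∈ O} {p | (reflect z).symm p ∈ B}).ncard = (Conf z O B).ncard := by
  symm
  refine ncard_eq_of_equiv ((Equiv.inv _).trans (MulAut.conj (reflect z)).toEquiv) fun π => ?_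
  have h1 : ∀ b, ((Equiv.inv _).trans (MulAut.conj (reflect z)).toEquiv) π b =
      reflect z (π.symm ((reflect z).symm b)) := fun b => rfl
  have h2 : ∀ b c, Arc (-z) {p | (p.1, -p.2) ∈ O} (reflect z c) (reflect z b) ↔ Arc z O b c := by
    intro b c
    simp only [Arc, reflect, Equiv.coe_fn_mk, Set.mem_ofPred_eq]
    have h3 : eps (-z) (1 - b.2) = - eps z b.2 := by unfold eps; split_ifs <;> omega
    rw [h3]
    refine or_congr ?_ (or_congr ?_ ?_)
    · constructor
      · rintro ⟨h, h'⟩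
        have : b.2 = c.2 := by omega
        rw [this] at h'
        exact ⟨by omega, by omega⟩
      · rintro ⟨h, h'⟩
        rw [h] at h' ⊢
        exact ⟨by omega, by omega⟩
    · constructor <;> rintro ⟨h, h'⟩ <;> exact ⟨by omega, by omega⟩
    · refine ⟨fun ⟨h, h', h''⟩ => ⟨by omega, by omega, ?_⟩, fun ⟨h, h', h''⟩ =>
        ⟨by omega, by omega, ?_⟩⟩
      · convert h'' using 2 <;> omega
      · convert h'' using 2 <;> omega
  simp only [Conf, Set.mem_ofPred_eq, h1]
  refine and_congr ⟨fun h b hb => ?_, fun h b hb => ?_⟩ ⟨fun h b => ?_, fun h b => ?_⟩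
  · have := h _ hb
    rw [(Equiv.symm_apply_eq π).2 this.symm]; simp
  · have := h (reflect z b) (by simpa using hb)
    simp only [Equiv.symm_apply_apply, EmbeddingLike.apply_eq_iff_eq] at this
    exact (Equiv.symm_apply_eq _).1 this |>.symm
  · have := h (π.symm ((reflect z).symm b))
    rw [← h2] at this
    simpa using this
  · have := h (reflect z (π b))
    simp only [Equiv.symm_apply_apply] at this
    exact (h2 _ _).1 this

/-- The functions `U` and `L` with integer arguments; `s` stands for `i - n - 1`. -/
def bd (m j κ s r c : ℤ) : ℤ := 2 * c + r - 3 - 2 * ((m * c + κ * r + s) / j)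

section bd

variable {m j κ s r r' c c' d : ℤ}

theorem odd_bd_add : Odd (bd m j κ s r c + r) := ⟨c + r - 2 - (m * c + κ * r + s) / j, by
  unfold bd; ring⟩

theorem div_add_mul_le (hj : 0 < j) {a b d : ℤ} (h : a + d * j ≤ b) : a / j + d ≤ b / j := by
  rw [← Int.add_mul_ediv_right a d hj.ne']
  exact Int.ediv_le_ediv hj h

theorem bd_row (hj : 0 < j) (hκ : j ≤ κ) (h : r ≤ r') :
    bd m j κ s r' c ≤ bd m j κ s r c - (r' - r) := by
  have := div_add_mul_le hj (a := m * c + κ * r + s) (b := m * c + κ * r' + s) (d := r' - r)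
    (by nlinarith)
  unfold bd; omega

theorem bd_col (hj : 0 < j) (hm : 2 * j ≤ m) (h : c ≤ c') :
    bd m j κ s r c' ≤ bd m j κ s r c - 2 * (c' - c) := by
  have := div_add_mul_le hj (a := m * c + κ * r + s) (b := m * c' + κ * r + s) (d := 2 * (c' - c))
    (by nlinarith)
  unfold bd; omega

theorem bd_cross (hj : 0 < j) (hκ : κ + j ≤ m) (h : r' = r + 1) :
    bd m j κ s r (c + 1) ≤ bd m j κ s r' c - 1 := by
  have := div_add_mul_le hj (a := m * c + κ * (r + 1) + s) (b := m * (c + 1) + κ * r + s) (d := 1)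
    (by nlinarith)
  rw [h]
  unfold bd; omega

theorem bd_add_j (hj : 0 < j) : bd m j κ (s + j) r c = bd m j κ s r c - 2 := by
  have := Int.add_mul_ediv_right (m * c + κ * r + s) 1 hj.ne'
  rw [one_mul, add_assoc] at this
  unfold bd
  rw [this]; ring

theorem bd_add_i (hj : 0 < j) : bd m j κ (s + (m - j)) r c = bd m j κ s r (c + 1) := by
  have := Int.add_mul_ediv_right (m * (c + 1) + κ * r + s) (-1) hj.ne'
  unfold bd
  rw [show m * c + κ * r + (s + (m - j)) = m * (c + 1) + κ * r + s + -1 * j by ring, this]; ring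

theorem bd_add_self (h : r' = r + 1) : bd m j κ (s + κ) r c = bd m j κ s r' c - 1 := by
  rw [h]; unfold bd
  rw [show m * c + κ * r + (s + κ) = m * c + κ * (r + 1) + s by ring]; ring

theorem bd_add_compl (h : r' = r - 1) :
    bd m j κ (s + (m - κ)) r c = bd m j κ s r' (c + 1) - 1 := by
  rw [h]; unfold bd
  rw [show m * c + κ * r + (s + (m - κ)) = m * (c + 1) + κ * (r - 1) + s by ring]; ring

theorem bd_compl : bd m j (m - κ) s (-1) 1 = bd m j κ s 1 0 := by
  unfold bd
  rw [show m * 1 + (m - κ) * -1 + s = m * 0 + κ * 1 + s by ring]; ring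

theorem bd_zero (κ') : bd m j κ s 0 c = bd m j κ' s 0 c := by simp [bd]

theorem exists_bd_succ (hj : 0 < j) (hm : 2 * j ≤ m) {x : ℤ} (h : x ≤ bd m j κ s r 1) :
    (∃ c, 0 ≤ c ∧ x = bd m j κ s r c) ↔ ∃ c, 0 ≤ c ∧ x = bd m j κ s r (c + 1) := by
  constructor
  · rintro ⟨c, hc, rfl⟩
    rcases hc.eq_or_lt with rfl | hc
    · have := bd_col (κ := κ) (s := s) (r := r) hj hm zero_le_one
      omega
    · exact ⟨c - 1, by omega, by rw [sub_add_cancel]⟩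
  · rintro ⟨c, hc, h⟩
    exact ⟨c + 1, by omega, h⟩

theorem eq_bd_zero (hj : 0 < j) (hm : 2 * j ≤ m) {x : ℤ} (h : bd m j κ s r 1 < x)
    (hx : ∃ c, 0 ≤ c ∧ x = bd m j κ s r c) : x = bd m j κ s r 0 := by
  obtain ⟨c, hc, rfl⟩ := hx
  rcases hc.eq_or_lt with rfl | hc
  · rfl
  · have := bd_col (κ := κ) (s := s) (r := r) hj hm (show 1 ≤ c by omega)
    omega

end bd

/-- The vertices of even coordinate sum of a pinecone. -/
def Bl (m j k l s : ℤ) : Set (ℤ × ℤ) :=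
  {p | Even (p.1 + p.2) ∧ ((1 ≤ p.2 ∧ p.2 ≤ p.1 ∧ p.1 ≤ bd m j k s (p.2 - 1) 0) ∨
    (p.2 ≤ 0 ∧ -p.2 ≤ p.1 ∧ p.1 < bd m j l s (-p.2) 0))}

/-- A set of lower vertices of odd vertical edges. -/
def Od (m j k l s : ℤ) : Set (ℤ × ℤ) :=
  {p | (0 ≤ p.2 ∧ ∃ c, 0 ≤ c ∧ p.1 = bd m j k s p.2 c) ∨
    (p.2 ≤ 0 ∧ ∃ c, 0 ≤ c ∧ p.1 = bd m j l s (-p.2) c)}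

section regions

variable {m j k l s : ℤ}

theorem mem_Od_of_nonneg {x y : ℤ} (h : 0 ≤ y) :
    (x, y) ∈ Od m j k l s ↔ ∃ c, 0 ≤ c ∧ x = bd m j k s y c := by
  refine ⟨?_, fun h' => Or.inl ⟨h, h'⟩⟩
  rintro (⟨_, h'⟩ | ⟨h1, c, hc, h'⟩)
  · exact h'
  · obtain rfl : y = 0 := le_antisymm h1 h
    simp only [neg_zero] at h'
    exact ⟨c, hc, h'.trans (bd_zero k)⟩

theorem mem_Od_of_nonpos {x y : ℤ} (h : y ≤ 0) :
    (x, y) ∈ Od m j k l s ↔ ∃ c, 0 ≤ c ∧ x = bd m j l s (-y) c := by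
  refine ⟨?_, fun h' => Or.inr ⟨h, h'⟩⟩
  rintro (⟨h1, c, hc, h'⟩ | ⟨_, h'⟩)
  · obtain rfl : y = 0 := le_antisymm h h1
    rw [neg_zero]
    exact ⟨c, hc, h'.trans (bd_zero l)⟩
  · exact h'

theorem Bl_subset (hj : 0 < j) (hk : j ≤ k) (hl : j ≤ l) :
    Bl m j k l s ⊆ Set.Icc 0 (bd m j k s 0 0) ×ˢ
      Set.Icc (-bd m j k s 0 0) (bd m j k s 0 0) := by
  rintro ⟨x, y⟩ ⟨-, ⟨h1, h2, h3⟩ | ⟨h1, h2, h3⟩⟩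
  · have := bd_row (m := m) (s := s) (c := 0) hj hk (show 0 ≤ y - 1 by omega)
    simp only [Set.mem_prod, Set.mem_Icc] at *
    omega
  · have := bd_row (m := m) (s := s) (c := 0) hj hl (show 0 ≤ -y by omega)
    rw [bd_zero k] at this
    simp only [Set.mem_prod, Set.mem_Icc] at *
    omega

theorem Bl_finite (hj : 0 < j) (hk : j ≤ k) (hl : j ≤ l) : (Bl m j k l s).Finite :=
  ((Set.finite_Icc _ _).prod (Set.finite_Icc _ _)).subset (Bl_subset hj hk hl)

theorem west (hj : 0 < j) (hk : j ≤ k) (hl : j ≤ l) (hm : k + l = m) :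
    {π ∈ Conf 0 (Od m j k l s) (Bl m j k l s) |
        π (bd m j k s 0 0, 1) ≠ (bd m j k s 0 0 - 1, 0)} =
      Conf 0 (Od m j k l (s + (m - j))) (Bl m j k l (s + (m - j))) := by
  have hm2 : 2 * j ≤ m := by omega
  have hkm : k + j ≤ m := by omega
  have hlm : l + j ≤ m := by omega
  have mem' : ∀ p, p ∈ Bl m j k l (s + (m - j)) ↔ Even (p.1 + p.2) ∧
      ((1 ≤ p.2 ∧ p.2 ≤ p.1 ∧ p.1 ≤ bd m j k s (p.2 - 1) 1) ∨
        (p.2 ≤ 0 ∧ -p.2 ≤ p.1 ∧ p.1 < bd m j l s (-p.2) 1)) := by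
    intro p
    simp only [Bl, bd_add_i hj, Set.mem_ofPred_eq, zero_add]
  have hw1 := bd_col (κ := k) (s := s) (r := 0) hj hm2 zero_le_one
  refine sep_conf_eq _ ?_ ?_ ?_ ?_
  · rintro p hp
    obtain ⟨h1, h2⟩ := (mem' p).1 hp
    have e1 := bd_col (κ := k) (s := s) (r := p.2 - 1) hj hm2 zero_le_one
    have e2 := bd_col (κ := l) (s := s) (r := - p.2) hj hm2 zero_le_one
    exact ⟨h1, by omega⟩
  · intro π hπ hQ
    have hX := fixed_of_forward π (X := {p ∈ Bl m j k l s | 1 ≤ p.2 ∧ bd m j k s (p.2 - 1) 1 < p.1})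
      ((Bl_finite hj hk hl).subset fun p hp => hp.1) (fun p => p.1) (by
      rintro ⟨x, y⟩ ⟨hb, h1, h2⟩ hne
      simp only at h1 h2
      have hc := (conf_mem hπ hne).2
      have harc := hπ.2 (x, y)
      obtain ⟨⟨x', y'⟩, hc'⟩ : ∃ c, c = π (x, y) := ⟨_, rfl⟩
      rw [← hc'] at hc harc hne ⊢
      have hne' : ¬ (x' = x ∧ y' = y) := fun h => hne (Prod.ext h.1 h.2)
      simp only [Arc, eps] at harc
      rcases harc with ⟨h3, h4⟩ | ⟨h3, h4⟩ | ⟨h3, h4, h5⟩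
      · subst h3
        rw [if_pos (by omega)] at h4
        exact ⟨⟨hc, h1, by simp only; omega⟩, by simp only; omega⟩
      · subst h3
        rw [if_pos (by omega)] at h4
        have := bd_row (m := m) (s := s) (c := 1) hj hk (show y - 1 ≤ y + 1 - 1 by omega)
        exact ⟨⟨hc, by simp only; omega, by simp only; omega⟩, by simp only; omega⟩
      · rw [mem_Od_of_nonneg (by omega)] at h5
        have h6 := eq_bd_zero hj hm2 h2 h5
        rcases h1.eq_or_lt with rfl | h1
        · refine absurd hc'.symm ?_
          rw [if_neg (by omega)] at h4
          simp only [sub_self] at h3 h6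
          rw [h4, h3, h6]
          exact hQ
        · rw [if_pos (by omega)] at h4
          have := bd_cross (m := m) (s := s) (c := 0) hj hkm (show y - 1 = y' - 1 + 1 by omega)
          rw [zero_add] at this
          exact ⟨⟨hc, by simp only; omega, by simp only; omega⟩, by simp only; omega⟩)
    have hY := fixed_of_backward π (X := {p ∈ Bl m j k l s | p.2 ≤ 0 ∧ bd m j l s (-p.2) 1 ≤ p.1})
      ((Bl_finite hj hk hl).subset fun p hp => hp.1) (fun p => p.1) (by
      rintro ⟨x, y⟩ ⟨hc, h1, h2⟩ hne
      have hb := (conf_mem hπ hne).1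
      have harc := hπ.2 (x, y)
      obtain ⟨⟨x', y'⟩, hc'⟩ : ∃ c, c = π (x, y) := ⟨_, rfl⟩
      rw [← hc'] at hc harc hne h1 h2 ⊢
      have hne' : ¬ (x' = x ∧ y' = y) := fun h => hne (Prod.ext h.1 h.2)
      simp only [Arc, eps] at harc h1 h2
      rw [if_neg (by omega)] at harc
      rcases harc with ⟨h3, h4⟩ | ⟨h3, h4⟩ | ⟨h3, h4, h5⟩
      · subst h3
        exact ⟨⟨hb, h1, by simp only; omega⟩, by simp only; omega⟩
      · subst h3
        have := bd_row (m := m) (s := s) (c := 1) hj hl (show -(y + 1) ≤ -y by omega)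
        exact ⟨⟨hb, by simp only; omega, by simp only; omega⟩, by simp only; omega⟩
      · rw [mem_Od_of_nonpos (by omega)] at h5
        have h6 := eq_bd_zero hj hm2 (by rw [← h3]; omega) h5
        rcases (show y ≤ 1 by omega).eq_or_lt with rfl | h7
        · refine absurd hc'.symm ?_
          simp only [sub_self, neg_zero] at h3 h6
          rw [bd_zero k] at h6
          rw [h4, h3, h6]
          exact hQ
        · have := bd_cross (m := m) (s := s) (c := 0) hj hlm (show -(y - 1) = -y + 1 by omega)
          rw [zero_add] at this
          exact ⟨⟨hb, by simp only; omega, by simp only; omega⟩, by simp only; omega⟩)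
    intro b hb hb'
    rw [mem'] at hb'
    by_cases h1 : 1 ≤ b.2
    · refine hX b ⟨hb, h1, ?_⟩
      by_contra h2
      exact hb' ⟨hb.1, by have := hb.2; omega⟩
    · refine hY b ⟨hb, by omega, ?_⟩
      by_contra h2
      exact hb' ⟨hb.1, by have := hb.2; omega⟩
  · intro π hπ
    rw [hπ.1]
    · simp
    · rw [mem']
      rintro ⟨-, h | h⟩ <;> simp only [sub_self] at h <;> omega
  · rintro ⟨x, y⟩ hb ⟨x', y'⟩ hc h1 h2
    rw [mem'] at hb hc
    simp only [eps] at *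
    by_cases hy : 1 ≤ y
    · rw [mem_Od_of_nonneg (by omega), mem_Od_of_nonneg (by omega),
        exists_bd_succ hj hm2 (by omega)]
      simp only [bd_add_i hj]
    · rw [if_neg (by omega)] at h2
      subst h1
      rw [mem_Od_of_nonpos (by omega), mem_Od_of_nonpos (by omega),
        exists_bd_succ hj hm2 (by omega)]
      simp only [bd_add_i hj]

theorem east (hj : 0 < j) (hk : j ≤ k) (hl : j ≤ l) :
    {π ∈ Conf 0 (Od m j k l s) (Bl m j k l s) | π (0, 0) ≠ (1, 1)} =
      Conf 0 {p | p - (2, 0) ∈ Od m j k l (s + j)} {p | p - (2, 0) ∈ Bl m j k l (s + j)} := by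
  have mem' : ∀ p, p ∈ {p | p - (2, 0) ∈ Bl m j k l (s + j)} ↔ Even (p.1 + p.2) ∧
      ((1 ≤ p.2 ∧ p.2 ≤ p.1 - 2 ∧ p.1 ≤ bd m j k s (p.2 - 1) 0) ∨
        (p.2 ≤ 0 ∧ -p.2 ≤ p.1 - 2 ∧ p.1 < bd m j l s (-p.2) 0)) := by
    intro p
    simp only [Bl, bd_add_j hj, Set.mem_ofPred_eq, Prod.fst_sub, Prod.snd_sub, sub_zero]
    refine and_congr ?_ (by omega)
    rw [show p.1 - 2 + p.2 = p.1 + p.2 - 2 by ring, Int.even_sub]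
    simp
  refine sep_conf_eq _ ?_ ?_ ?_ ?_
  · rintro p hp
    obtain ⟨h1, h2⟩ := (mem' p).1 hp
    exact ⟨h1, by omega⟩
  · intro π hπ hQ
    have hX := fixed_of_backward π (X := {p ∈ Bl m j k l s | 1 ≤ p.2 ∧ p.1 = p.2})
      ((Bl_finite hj hk hl).subset fun p hp => hp.1) (fun p => -p.1) (by
      rintro ⟨x, y⟩ ⟨hc, h1, h2⟩ hne
      have hb := (conf_mem hπ hne).1
      have harc := hπ.2 (x, y)
      obtain ⟨⟨x', y'⟩, hc'⟩ : ∃ c, c = π (x, y) := ⟨_, rfl⟩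
      rw [← hc'] at hc harc hne h1 h2 ⊢
      have hne' : ¬ (x' = x ∧ y' = y) := fun h => hne (Prod.ext h.1 h.2)
      simp only [Arc, eps] at harc h1 h2
      rw [if_pos (by omega)] at harc
      have hb2 := hb.2
      simp only at hb2
      rcases harc with ⟨h3, h4⟩ | ⟨h3, h4⟩ | ⟨h3, h4, h5⟩
      · omega
      · by_cases hy : y = 0
        · refine absurd hc'.symm ?_
          rw [show x = 0 by omega, show x' = 1 by omega, show y' = 1 by omega, hy]
          exact hQ
        · exact ⟨⟨hb, by simp only; omega, by simp only; omega⟩, by simp only; omega⟩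
      · omega)
    have hY := fixed_of_forward π (X := {p ∈ Bl m j k l s | p.2 ≤ 0 ∧ p.1 = -p.2})
      ((Bl_finite hj hk hl).subset fun p hp => hp.1) (fun p => -p.1) (by
      rintro ⟨x, y⟩ ⟨hb, h1, h2⟩ hne
      simp only at h1 h2
      have hc := (conf_mem hπ hne).2
      have harc := hπ.2 (x, y)
      obtain ⟨⟨x', y'⟩, hc'⟩ : ∃ c, c = π (x, y) := ⟨_, rfl⟩
      rw [← hc'] at hc harc hne ⊢
      have hne' : ¬ (x' = x ∧ y' = y) := fun h => hne (Prod.ext h.1 h.2)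
      have hc2 := hc.2
      simp only at hc2
      simp only [Arc, eps] at harc
      by_cases hy : 0 < y'
      · refine absurd hc'.symm ?_
        rw [if_pos hy] at harc
        rw [show x = 0 by omega, show x' = 1 by omega, show y' = 1 by omega, show y = 0 by omega]
        exact hQ
      · rw [if_neg hy] at harc
        exact ⟨⟨hc, by simp only; omega, by simp only; omega⟩, by simp only; omega⟩)
    rintro ⟨x, y⟩ hb hb'
    rw [mem'] at hb'
    obtain ⟨⟨u, hu⟩, hb2⟩ := id hb
    simp only at hb2 hu
    have hb3 := not_and.1 hb' ⟨u, hu⟩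
    simp only at hb3
    by_cases h1 : 1 ≤ y
    · exact hX _ ⟨hb, h1, by simp only; omega⟩
    · exact hY _ ⟨hb, by simp only; omega, by simp only; omega⟩
  · intro π hπ
    rw [hπ.1]
    · simp
    · rw [mem']
      rintro ⟨-, h | h⟩ <;> simp only at h <;> omega
  · rintro ⟨x, y⟩ hb ⟨x', y'⟩ hc h1 h2
    have e : ((x, y - 1) : ℤ × ℤ) - (2, 0) = (x - 2, y - 1) := by simp
    rw [Set.mem_ofPred_eq, e]
    by_cases hy : 1 ≤ y
    · rw [mem_Od_of_nonneg (by omega), mem_Od_of_nonneg (by omega)]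
      simp only [bd_add_j hj, sub_left_inj]
    · rw [mem_Od_of_nonpos (by omega), mem_Od_of_nonpos (by omega)]
      simp only [bd_add_j hj, sub_left_inj]

theorem north (hj : 0 < j) (hk : j ≤ k) (hl : j ≤ l) (hm : k + l = m) :
    Conf 1 (Od m j k l s) (Bl m j k l s \ {(bd m j k s 0 0, 1)}) =
      Conf 1 {p | p - (1, 1) ∈ Od m j k l (s + k)} {p | p - (1, 1) ∈ Bl m j k l (s + k)} := by
  have hm2 : 2 * j ≤ m := by omega
  have hkm : k + j ≤ m := by omega
  have hlm : l + j ≤ m := by omega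
  obtain rfl : l = m - k := by omega
  have hcompl : bd m j (m - k) s (-1) 1 = bd m j k s 1 0 := bd_compl
  have hkl : k = m - (m - k) := by ring
  have up : ∀ r r' c, r' = r + 1 → bd m j k (s + k) r c = bd m j k s r' c - 1 :=
    fun r r' c h => bd_add_self h
  have low : ∀ r r' c, r' = r - 1 → bd m j (m - k) (s + k) r c = bd m j (m - k) s r' (c + 1) - 1 := by
    intro r r' c h
    rw [← bd_add_compl h, ← hkl]
  have row1 := bd_row (m := m) (s := s) (c := 0) hj hk zero_le_one
  have mem' : ∀ p, p ∈ {p | p - (1, 1) ∈ Bl m j k (m - k) (s + k)} ↔ Even (p.1 + p.2) ∧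
      ((2 ≤ p.2 ∧ p.2 ≤ p.1 ∧ p.1 ≤ bd m j k s (p.2 - 1) 0) ∨
        (p.2 ≤ 1 ∧ 2 - p.2 ≤ p.1 ∧ p.1 < bd m j (m - k) s (-p.2) 1)) := by
    intro p
    have e1 := up (p.2 - 1 - 1) (p.2 - 1) 0 (by ring)
    have e2 := low (-(p.2 - 1)) (-p.2) 0 (by ring)
    rw [zero_add] at e2
    simp only [Bl, e1, e2, Set.mem_ofPred_eq, Prod.fst_sub, Prod.snd_sub]
    refine and_congr ?_ (by omega)
    rw [show p.1 - 1 + (p.2 - 1) = p.1 + p.2 - 2 by ring, Int.even_sub]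
    simp
  refine Eq.trans ?_ (sep_conf_eq (fun _ => True) (O := Od m j k (m - k) s)
    (B := Bl m j k (m - k) s \ {(bd m j k s 0 0, 1)}) ?_ ?_ ?_ ?_)
  · simp
  · rintro ⟨x, y⟩ hp
    obtain ⟨⟨u, hu⟩, h2⟩ := (mem' (x, y)).1 hp
    simp only at h2 hu
    have e2 := bd_col (κ := m - k) (s := s) (r := -y) hj hm2 zero_le_one
    refine ⟨⟨⟨u, hu⟩, ?_⟩, ?_⟩
    · simp only
      by_cases hy : y = 1
      · subst hy
        rw [hcompl] at h2
        simp only [sub_self]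
        omega
      · omega
    · rintro h
      have h3 : x = bd m j k s 0 0 := congrArg Prod.fst h
      have h4 : y = 1 := congrArg Prod.snd h
      subst h4
      rw [hcompl] at h2
      omega
  · intro π hπ _
    have hX := fixed_of_forward π
      (X := {p ∈ Bl m j k (m - k) s \ {(bd m j k s 0 0, 1)} | p.2 ≤ 0 ∧ p.1 = -p.2})
      ((Bl_finite hj hk hl).subset fun p hp => hp.1.1) (fun p => -p.1) (by
      rintro ⟨x, y⟩ ⟨hb, h1, h2⟩ hne
      simp only at h1 h2
      have hc := (conf_mem hπ hne).2
      have harc := hπ.2 (x, y)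
      obtain ⟨⟨x', y'⟩, hc'⟩ : ∃ c, c = π (x, y) := ⟨_, rfl⟩
      rw [← hc'] at hc harc hne ⊢
      have hne' : ¬ (x' = x ∧ y' = y) := fun h => hne (Prod.ext h.1 h.2)
      have hc2 := hc.1.2
      simp only at hc2
      simp only [Arc, eps] at harc
      rw [if_neg (by omega)] at harc
      exact ⟨⟨hc, by simp only; omega, by simp only; omega⟩, by simp only; omega⟩)
    have hY := fixed_of_backward π
      (X := {p ∈ Bl m j k (m - k) s \ {(bd m j k s 0 0, 1)} |
        p.2 ≤ 1 ∧ bd m j (m - k) s (-p.2) 1 ≤ p.1})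
      ((Bl_finite hj hk hl).subset fun p hp => hp.1.1) (fun p => p.1) (by
      rintro ⟨x, y⟩ ⟨hc, h1, h2⟩ hne
      have hb := (conf_mem hπ hne).1
      have harc := hπ.2 (x, y)
      obtain ⟨⟨x', y'⟩, hc'⟩ : ∃ c, c = π (x, y) := ⟨_, rfl⟩
      rw [← hc'] at hc harc hne h1 h2 ⊢
      have hne' : ¬ (x' = x ∧ y' = y) := fun h => hne (Prod.ext h.1 h.2)
      simp only [Arc, eps] at harc h1 h2
      rw [if_neg (by omega)] at harc
      rcases harc with ⟨h3, h4⟩ | ⟨h3, h4⟩ | ⟨h3, h4, h5⟩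
      · subst h3
        exact ⟨⟨hb, h1, by simp only; omega⟩, by simp only; omega⟩
      · subst h3
        have := bd_row (m := m) (s := s) (c := 1) hj hl (show -(y + 1) ≤ -y by omega)
        exact ⟨⟨hb, by simp only; omega, by simp only; omega⟩, by simp only; omega⟩
      · by_cases hy : y = 2
        · subst hy
          have hb2 := hb.1.2
          simp only at hb2
          obtain rfl : y' = 1 := by omega
          rw [hcompl] at h2
          norm_num at hb2
          omega
        · rw [mem_Od_of_nonpos (by omega)] at h5
          have h6 := eq_bd_zero hj hm2 (by rw [← h3]; omega) h5
          by_cases hy1 : y = 1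
          · subst hy1
            simp only [sub_self, neg_zero] at h6
            rw [bd_zero k] at h6
            exact (hb.2 (by simp [h6])).elim
          · have := bd_cross (m := m) (s := s) (c := 0) hj hlm (show -(y - 1) = -y + 1 by omega)
            rw [zero_add] at this
            exact ⟨⟨hb, by simp only; omega, by simp only; omega⟩, by simp only; omega⟩)
    rintro ⟨x, y⟩ hb hb'
    rw [mem'] at hb'
    obtain ⟨⟨u, hu⟩, hb2⟩ := id hb.1
    simp only at hb2 hu
    have hb3 := not_and.1 hb' ⟨u, hu⟩
    simp only at hb3
    by_cases h1 : y ≤ 0 ∧ x = -y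
    · exact hX _ ⟨hb, h1⟩
    · exact hY _ ⟨hb, by simp only; omega, by simp only; omega⟩
  · intro _ _; trivial
  · rintro ⟨x, y⟩ hb ⟨x', y'⟩ hc h1 h2
    rw [mem'] at hb hc
    simp only [eps] at *
    have e : ((x, y - 1) : ℤ × ℤ) - (1, 1) = (x - 1, y - 2) := Prod.ext rfl (by simp; ring)
    rw [Set.mem_ofPred_eq, e]
    by_cases hy : 2 ≤ y
    · rw [mem_Od_of_nonneg (by omega), mem_Od_of_nonneg (by omega)]
      simp only [up (y - 2) (y - 1) _ (by ring), sub_left_inj]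
    · rw [if_neg (by omega)] at h2
      subst h1
      rw [mem_Od_of_nonpos (by omega), mem_Od_of_nonpos (by omega),
        exists_bd_succ hj hm2 (by omega)]
      simp only [low (-(y - 2)) (-(y - 1)) _ (by ring), sub_left_inj]

theorem reflect_Od : {p : ℤ × ℤ | (p.1, -p.2) ∈ Od m j k l s} = Od m j l k s := by
  ext p
  simp only [Od, Set.mem_ofPred_eq, neg_neg]
  rw [or_comm]
  refine or_congr (and_congr (by omega) Iff.rfl) (and_congr (by omega) Iff.rfl)

theorem reflect_Bl : {p | (reflect 0).symm p ∈ Bl m j k l s} = Bl m j l k s := by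
  ext ⟨x, y⟩
  simp only [reflect, Equiv.coe_fn_symm_mk, Bl, Set.mem_ofPred_eq, eps, neg_zero]
  rw [show 1 - y - 1 = -y by ring, show -(1 - y) = y - 1 by ring]
  by_cases hy : 0 < y
  · rw [if_pos hy]
    refine and_congr ⟨fun ⟨u, hu⟩ => ⟨u + y, by omega⟩, fun ⟨u, hu⟩ => ⟨u - y, by omega⟩⟩ (by omega)
  · rw [if_neg hy]
    refine and_congr ⟨fun ⟨u, hu⟩ => ⟨u + y - 1, by omega⟩, fun ⟨u, hu⟩ => ⟨u - y + 1, by omega⟩⟩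
      (by omega)

theorem reflect_Bl_diff : {p | (reflect (-1)).symm p ∈ Bl m j k l s \ {(0, 0)}} =
    Bl m j l k s \ {(bd m j l s 0 0, 1)} := by
  ext ⟨x, y⟩
  obtain ⟨v, hv⟩ := odd_bd_add (m := m) (j := j) (κ := l) (s := s) (r := 0) (c := 0)
  simp only [reflect, Equiv.coe_fn_symm_mk, Bl, Set.mem_ofPred_eq, eps, neg_neg, Set.mem_sdiff,
    Set.mem_singleton_iff, Prod.mk.injEq]
  rw [show 1 - y - 1 = -y by ring, show -(1 - y) = y - 1 by ring]
  by_cases hy : 1 < y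
  · rw [if_pos hy]
    refine and_congr (and_congr ⟨fun ⟨u, hu⟩ => ⟨u + y, by omega⟩,
      fun ⟨u, hu⟩ => ⟨u - y, by omega⟩⟩ (by omega)) (by omega)
  · rw [if_neg hy]
    by_cases hy1 : y = 1
    · subst hy1
      rw [sub_self]
      constructor
      · rintro ⟨⟨⟨u, hu⟩, h1⟩, h2⟩
        exact ⟨⟨⟨u, by omega⟩, by omega⟩, by omega⟩
      · rintro ⟨⟨⟨u, hu⟩, h1⟩, h2⟩
        exact ⟨⟨⟨u, by omega⟩, by omega⟩, by omega⟩
    · refine and_congr (and_congr ⟨fun ⟨u, hu⟩ => ⟨u + y - 1, by omega⟩,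
        fun ⟨u, hu⟩ => ⟨u - y + 1, by omega⟩⟩ (by omega)) (by omega)

/-- The number of matchings of a pinecone. -/
noncomputable def num (m j k l s : ℤ) : ℕ := (Conf 0 (Od m j k l s) (Bl m j k l s)).ncard

theorem num_comm : num m j k l s = num m j l k s := by
  unfold num
  rw [← ncard_conf_reflect, reflect_Od, reflect_Bl, neg_zero]

theorem ncard_north (hj : 0 < j) (hk : j ≤ k) (hl : j ≤ l) (hm : k + l = m) :
    (Conf 1 (Od m j k l s) (Bl m j k l s \ {(bd m j k s 0 0, 1)})).ncard = num m j k l (s + k) := by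
  rw [north hj hk hl hm]
  exact ncard_conf_translate (z := 0) (1, 1)

theorem ncard_south (hj : 0 < j) (hk : j ≤ k) (hl : j ≤ l) (hm : k + l = m) :
    (Conf (-1) (Od m j k l s) (Bl m j k l s \ {(0, 0)})).ncard = num m j k l (s + l) := by
  rw [← ncard_conf_reflect, reflect_Od, reflect_Bl_diff, neg_neg,
    ncard_north hj hl hk (by omega), num_comm]

theorem ncard_east (hj : 0 < j) (hk : j ≤ k) (hl : j ≤ l) :
    {π ∈ Conf 0 (Od m j k l s) (Bl m j k l s) | π (0, 0) ≠ (1, 1)}.ncard =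
      num m j k l (s + j) := by
  rw [east hj hk hl]
  exact ncard_conf_translate (z := 0) (2, 0)

theorem ncard_center (hj : 0 < j) (hk : j ≤ k) (hl : j ≤ l) (hm : k + l = m) :
    {π ∈ Conf 0 (Od m j k l s) (Bl m j k l s) | π (0, 0) ≠ (1, 1) ∧
        π (bd m j k s 0 0, 1) ≠ (bd m j k s 0 0 - 1, 0)}.ncard = num m j k l (s + m) := by
  have h1 := ncard_sep_conf_translate (z := 0) (O := Od m j k l (s + j)) (B := Bl m j k l (s + j))
    (2, 0) (bd m j k (s + j) 0 0, 1) (bd m j k (s + j) 0 0 - 1, 0)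
  rw [west hj hk hl hm, add_assoc, add_sub_cancel] at h1
  unfold num
  rw [← h1]
  congr 1
  ext π
  have h2 := Set.ext_iff.1 (east (m := m) (s := s) hj hk hl) π
  simp only [Set.mem_ofPred_eq, bd_add_j hj, add_zero] at h2 ⊢
  rw [← h2, ← and_assoc]
  simp only [Prod.mk_add_mk, sub_add_cancel, add_zero]
  rw [show bd m j k s 0 0 - 2 - 1 + 2 = bd m j k s 0 0 - 1 by ring]

theorem num_recurrence (hj : 0 < j) (hk : j ≤ k) (hl : j ≤ l) (hm : k + l = m)
    (hw : 1 ≤ bd m j k s 0 0) :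
    num m j k l s * num m j k l (s + m) =
      num m j k l (s + (m - j)) * num m j k l (s + j) +
        num m j k l (s + k) * num m j k l (s + l) := by
  have : Fintype (Bl m j k l s) := (Bl_finite hj hk hl).fintype
  have hodd : Odd (bd m j k s 0 0) := by simpa using odd_bd_add (r := (0 : ℤ))
  have key := kuo_conf (B := Bl m j k l s) (w := bd m j k s 0 0) (O := Od m j k l s) ?_ ?_ hodd hw
    ?_ ?_ ?_
  · rw [ncard_center hj hk hl hm, ncard_east hj hk hl, west hj hk hl hm, ncard_north hj hk hl hm,
      ncard_south hj hk hl hm] at key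
    rw [mul_comm (num m j k l (s + (m - j)))]
    exact key
  · intro x
    simp only [Bl, Set.mem_ofPred_eq, sub_self]
    rw [Int.even_add_one, Int.not_even_iff_odd]
    refine and_congr_right fun _ => by omega
  · intro x
    simp only [Bl, Set.mem_ofPred_eq, neg_zero, add_zero, bd_zero (κ := l) k]
    refine and_congr_right fun _ => by omega
  · exact (mem_Od_of_nonneg le_rfl).2 ⟨0, le_rfl, rfl⟩
  · rintro x y hy ⟨⟨u, hu⟩, h1⟩ ⟨-, h2⟩ ⟨-, h3⟩
    refine ⟨⟨u + 1, by simp only at hu ⊢; omega⟩, ?_⟩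
    simp only [add_sub_cancel_right] at *
    rcases (show 0 ≤ y by omega).eq_or_lt with rfl | hy
    · rw [neg_zero, bd_zero k] at *
      omega
    · have := bd_row (m := m) (s := s) (c := 0) hj hk (show y - 1 ≤ y by omega)
      omega
  · rintro x y hy ⟨⟨u, hu⟩, h1⟩ ⟨-, h2⟩ ⟨-, h3⟩
    refine ⟨⟨u, by simp only at hu ⊢; omega⟩, ?_⟩
    simp only [add_sub_cancel_right] at *
    rcases (show y ≤ 0 by omega).eq_or_lt with rfl | hy
    · rw [neg_zero, bd_zero k] at *
      obtain ⟨v, hv⟩ := hodd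
      omega
    · have := bd_row (m := m) (s := s) (c := 0) hj hl (show -(y + 1) ≤ -y by omega)
      omega

end regions

theorem squareGrid_adj_parity {v w : ℤ × ℤ} (h : squareGrid.Adj v w) :
    Even (v.1 + v.2) ↔ Odd (w.1 + w.2) := by
  rw [← Int.not_even_iff_odd]
  rcases h with ⟨h1, h2⟩ | ⟨h1, h2⟩ <;>
    rcases (abs_eq zero_le_one).1 h2 with h | h <;> constructor <;>
    rintro h3 <;> rw [Int.even_iff] at * <;> omega

/-- The matching of a pinecone given by a permutation of its even vertices. -/
def permMatching {P : squareGrid.Subgraph} {B O : Set (ℤ × ℤ)}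
    (hadj : ∀ b ∈ B, ∀ c ∈ B, P.Adj b (c.1 - eps 0 c.2, c.2) ↔ Arc 0 O b c)
    (π : {π : Perm B // ∀ b, Arc 0 O b.1 (π b).1}) : P.coe.Subgraph where
  verts := Set.univ
  Adj v w := (∃ b : B, v.1 = b ∧ w.1 = ((π.1 b).1.1 - eps 0 (π.1 b).1.2, (π.1 b).1.2)) ∨
    (∃ b : B, w.1 = b ∧ v.1 = ((π.1 b).1.1 - eps 0 (π.1 b).1.2, (π.1 b).1.2))
  adj_sub := by
    rintro v w (⟨b, h1, h2⟩ | ⟨b, h1, h2⟩)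
    · rw [SimpleGraph.Subgraph.coe_adj, h1, h2]
      exact (hadj _ b.2 _ (π.1 b).2).2 (π.2 b)
    · rw [SimpleGraph.Subgraph.coe_adj, h1, h2]
      exact ((hadj _ b.2 _ (π.1 b).2).2 (π.2 b)).symm
  edge_vert _ := Set.mem_univ _
  symm := ⟨fun _ _ h => h.symm⟩

theorem matchingNumber_eq_ncard (P : squareGrid.Subgraph) {B O : Set (ℤ × ℤ)} (hfin : B.Finite)
    (heven : ∀ b ∈ B, Even (b.1 + b.2)) (hB : ∀ v : ℤ × ℤ, Even (v.1 + v.2) → (v ∈ P.verts ↔ v ∈ B))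
    (hW : ∀ v : ℤ × ℤ, Odd (v.1 + v.2) → (v ∈ P.verts ↔ (v.1 + eps 0 v.2, v.2) ∈ B))
    (hadj : ∀ b ∈ B, ∀ c ∈ B, P.Adj b (c.1 - eps 0 c.2, c.2) ↔ Arc 0 O b c) :
    matchingNumber P = (Conf 0 O B).ncard := by
  have : Finite B := hfin
  have hcard := card_perm_conf 0 O B (fun _ => True) (fun _ => True) fun _ _ _ => Iff.rfl
  simp only [and_true] at hcard
  rw [show Conf 0 O B = {π | π ∈ Conf 0 O B} from rfl, ← hcard, matchingNumber]
  symm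
  have hodd : ∀ c ∈ B, Odd (c.1 - eps 0 c.2 + c.2) := by
    intro c hc
    obtain ⟨u, hu⟩ := heven c hc
    unfold eps
    split_ifs
    · exact ⟨u - 1, by omega⟩
    · exact ⟨u, by omega⟩
  have hρ : ∀ c ∈ B, ((c.1 - eps 0 c.2, c.2) : ℤ × ℤ) ∈ P.verts := by
    intro c hc
    rw [hW _ (hodd c hc)]
    simpa using hc
  have hne : ∀ b ∈ B, ∀ c ∈ B, b ≠ (c.1 - eps 0 c.2, c.2) := by
    intro b hb c hc h
    have := hodd c hc
    rw [← Int.not_even_iff_odd] at this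
    exact this (by have := heven b hb; rwa [h] at this)
  have hinj : ∀ b c : ℤ × ℤ,
      ((b.1 - eps 0 b.2, b.2) : ℤ × ℤ) = (c.1 - eps 0 c.2, c.2) → b = c := by
    intro b c h
    obtain ⟨h1, h2⟩ := Prod.mk.inj h
    rw [h2] at h1
    exact Prod.ext (by omega) h2
  have hmem : ∀ v : ℤ × ℤ, v ∈ P.verts → v ∈ B ∨ ∃ c ∈ B, v = (c.1 - eps 0 c.2, c.2) := by
    intro v hv
    by_cases h : Even (v.1 + v.2)
    · exact Or.inl ((hB v h).1 hv)
    · exact Or.inr ⟨_, (hW v (Int.not_even_iff_odd.1 h)).1 hv, Prod.ext (by simp) rfl⟩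
  refine Nat.card_congr (Equiv.ofBijective
    (fun π => ⟨permMatching hadj π, ?_, fun v => Set.mem_univ v⟩) ⟨?_, ?_⟩)
  · rintro v -
    rcases hmem v.1 v.2 with hv | ⟨c, hc, hv⟩
    · refine ⟨⟨_, hρ _ (π.1 ⟨v.1, hv⟩).2⟩, Or.inl ⟨⟨v.1, hv⟩, rfl, rfl⟩, ?_⟩
      rintro w (⟨b, h1, h2⟩ | ⟨b, h1, h2⟩)
      · obtain rfl : b = ⟨v.1, hv⟩ := Subtype.ext h1.symm
        exact Subtype.ext h2
      · exact absurd h2 (hne _ hv _ (π.1 b).2)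
    · have hb := (π.1.symm ⟨c, hc⟩).2
      refine ⟨⟨_, (hB _ (heven _ hb)).2 hb⟩, Or.inr ⟨_, rfl, ?_⟩, ?_⟩
      · rw [π.1.apply_symm_apply]; exact hv
      · rintro w (⟨b, h1, h2⟩ | ⟨b, h1, h2⟩)
        · rw [hv] at h1
          exact absurd h1.symm (hne _ b.2 _ hc)
        · rw [hv] at h2
          have h3 : π.1 b = ⟨c, hc⟩ := Subtype.ext (hinj _ _ h2).symm
          refine Subtype.ext (h1.trans ?_)
          exact congrArg Subtype.val (show b = π.1.symm ⟨c, hc⟩ by rw [← h3, π.1.symm_apply_apply])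
  · intro π π' h
    have h' : permMatching hadj π = permMatching hadj π' := congrArg Subtype.val h
    refine Subtype.ext (Equiv.ext fun b => ?_)
    have h1 : (permMatching hadj π).Adj ⟨b.1, (hB _ (heven _ b.2)).2 b.2⟩
      ⟨_, hρ _ (π.1 b).2⟩ := Or.inl ⟨b, rfl, rfl⟩
    rw [h'] at h1
    rcases h1 with ⟨b', h1, h2⟩ | ⟨b', h1, h2⟩
    · obtain rfl : b = b' := Subtype.ext h1
      exact Subtype.ext (hinj _ _ h2)
    · exact absurd h1.symm (hne _ b'.2 _ (π.1 b).2)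
  · rintro ⟨M, hM, hS⟩
    have hex : ∀ b : B, ∃ c : B, M.Adj ⟨b.1, (hB _ (heven _ b.2)).2 b.2⟩ ⟨_, hρ _ c.2⟩ := by
      intro b
      obtain ⟨w, hw, -⟩ := hM (hS ⟨b.1, (hB _ (heven _ b.2)).2 b.2⟩)
      have h1 := (squareGrid_adj_parity (P.adj_sub (M.adj_sub hw))).1 (heven _ b.2)
      have h2 := (hW _ h1).1 w.2
      refine ⟨⟨_, h2⟩, ?_⟩
      convert hw using 1
      exact Subtype.ext (Prod.ext (by simp) rfl)
    choose f hf using hex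
    have hfi : Function.Injective f := by
      intro b b' h
      have h1 := hf b
      have h2 := hf b'
      rw [← h] at h2
      have := (hM (hS _)).unique h1.symm h2.symm
      exact Subtype.ext (congrArg (fun v => v.1) this)
    let π : Perm B := Equiv.ofBijective f (Finite.injective_iff_bijective.1 hfi)
    have hπ : ∀ b, π b = f b := fun b => rfl
    refine ⟨⟨π, fun b => (hadj _ b.2 _ (π b).2).1 (M.adj_sub (hf b))⟩, Subtype.ext ?_⟩
    have key : ∀ v w : P.verts, M.Adj v w → v.1 ∈ B →
        ∃ b : B, v.1 = b ∧ w.1 = ((π b).1.1 - eps 0 (π b).1.2, (π b).1.2) := by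
      intro v w h hv
      refine ⟨⟨v.1, hv⟩, rfl, ?_⟩
      exact congrArg Subtype.val ((hM (hS v)).unique h (hf ⟨v.1, hv⟩))
    refine SimpleGraph.Subgraph.ext (Set.eq_univ_of_forall hS).symm ?_
    ext v w
    constructor
    · rintro (⟨b, h1, h2⟩ | ⟨b, h1, h2⟩)
      · have := hf b
        convert this using 1
        · exact Subtype.ext h1
        · exact Subtype.ext h2
      · have := (hf b).symm
        convert this using 1
        · exact Subtype.ext h2
        · exact Subtype.ext h1
    · intro h
      by_cases hv : Even (v.1.1 + v.1.2)
      · exact Or.inl (key v w h ((hB _ hv).1 v.2))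
      · have hw := (squareGrid_adj_parity (P.adj_sub (M.adj_sub h.symm))).2
          (Int.not_even_iff_odd.1 hv)
        exact Or.inr (key w v h.symm ((hB _ hw).1 w.2))

section pinecone

variable {i j k ℓ n : ℕ} {m s : ℤ}

theorem U_eq_bd (hm : m = i + j) (hs : s = i - n - 1) (r c : ℕ) :
    U i j k n r c = bd m j k s r c := by
  unfold U bd
  rw [hm, hs, show ((i : ℤ) + j) * c + k * r + i - n - 1 = (i + j) * c + k * r + (i - n - 1) by ring]

theorem L_eq_bd (hm : m = i + j) (hs : s = i - n - 1) (r c : ℕ) :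
    L i j ℓ n r c = bd m j ℓ s r c :=
  U_eq_bd hm hs r c

theorem HEdge_iff (hm : m = i + j) (hs : s = i - n - 1) (x y : ℤ) :
    HEdge i j k ℓ n x y ↔ (1 ≤ y ∧ y - 1 ≤ x ∧ x < bd m j k s (y - 1) 0) ∨
      (y ≤ 0 ∧ -y ≤ x ∧ x < bd m j ℓ s (-y) 0) := by
  simp only [HEdge, U_eq_bd hm hs, L_eq_bd hm hs]
  constructor
  · rintro ⟨r, ⟨rfl, h1, h2⟩ | ⟨rfl, h1, h2⟩⟩
    · left
      rw [add_sub_cancel_right]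
      exact ⟨by omega, h1, h2⟩
    · right
      rw [neg_neg]
      exact ⟨by omega, h1, h2⟩
  · rintro (⟨h1, h2, h3⟩ | ⟨h1, h2, h3⟩)
    · obtain ⟨r, hr⟩ := Int.eq_ofNat_of_zero_le (show 0 ≤ y - 1 by omega)
      rw [hr] at h3
      exact ⟨r, Or.inl ⟨by omega, by omega, h3⟩⟩
    · obtain ⟨r, hr⟩ := Int.eq_ofNat_of_zero_le (show 0 ≤ -y by omega)
      rw [hr] at h3
      exact ⟨r, Or.inr ⟨by omega, by omega, h3⟩⟩

theorem mem_pineVerts_iff (hm : m = i + j) (hs : s = i - n - 1) (x y : ℤ) :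
    (x, y) ∈ pineVerts i j k ℓ n ↔
      (1 ≤ y ∧ y - 1 ≤ x ∧ x ≤ bd m j k s (y - 1) 0 ∧ y - 1 < bd m j k s (y - 1) 0) ∨
      (y ≤ 0 ∧ -y ≤ x ∧ x ≤ bd m j ℓ s (-y) 0 ∧ -y < bd m j ℓ s (-y) 0) := by
  simp only [pineVerts, Set.mem_ofPred_eq, HEdge_iff hm hs]
  omega

theorem mem_oddSet_iff (hm : m = i + j) (hs : s = i - n - 1) (x y : ℤ) :
    (x, y) ∈ oddSet i j k ℓ n ↔ (0 ≤ y ∧ y < x ∧ ∃ c, 0 ≤ c ∧ x = bd m j k s y c) ∨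
      (y ≤ 0 ∧ -y < x ∧ ∃ c, 0 ≤ c ∧ x = bd m j ℓ s (-y) c) := by
  simp only [oddSet, U_eq_bd hm hs, L_eq_bd hm hs, Set.mem_ofPred_eq, Prod.mk.injEq]
  constructor
  · rintro ⟨r, c, ⟨⟨h1, rfl⟩, h2⟩ | ⟨⟨h1, rfl⟩, h2⟩⟩
    · exact Or.inl ⟨by omega, by omega, c, by omega, h1⟩
    · exact Or.inr ⟨by omega, by omega, c, by omega, by rw [neg_neg, h1]⟩
  · rintro (⟨h1, h2, c, hc, h3⟩ | ⟨h1, h2, c, hc, h3⟩)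
    · obtain ⟨r, rfl⟩ := Int.eq_ofNat_of_zero_le h1
      obtain ⟨c, rfl⟩ := Int.eq_ofNat_of_zero_le hc
      exact ⟨r, c, Or.inl ⟨⟨h3, rfl⟩, by omega⟩⟩
    · obtain ⟨r, hr⟩ := Int.eq_ofNat_of_zero_le (show 0 ≤ -y by omega)
      obtain ⟨c, rfl⟩ := Int.eq_ofNat_of_zero_le hc
      rw [hr] at h3
      exact ⟨r, c, Or.inr ⟨⟨h3, by omega⟩, by omega⟩⟩

theorem pinecone_adj_iff (x y x' y' : ℤ) : (pinecone n i j k ℓ).Adj (x, y) (x', y') ↔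
    (y' = y ∧ x' = x + 1 ∧ HEdge i j k ℓ n x y) ∨ (y' = y ∧ x' = x - 1 ∧ HEdge i j k ℓ n x' y) ∨
    (x' = x ∧ y' = y + 1 ∧ (x, y) ∈ pineVerts i j k ℓ n ∧ (x, y + 1) ∈ pineVerts i j k ℓ n ∧
      (Even (x + y) ∨ (x, y) ∈ oddSet i j k ℓ n)) ∨
    (x' = x ∧ y' = y - 1 ∧ (x, y - 1) ∈ pineVerts i j k ℓ n ∧ (x, y) ∈ pineVerts i j k ℓ n ∧
      (Even (x + (y - 1)) ∨ (x, y - 1) ∈ oddSet i j k ℓ n)) := by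
  simp only [pinecone, PineEdge, Prod.mk.injEq]
  constructor
  · rintro ((⟨⟨rfl, rfl⟩, h⟩ | ⟨⟨rfl, rfl⟩, h⟩) | (⟨⟨rfl, rfl⟩, h⟩ | ⟨⟨rfl, rfl⟩, h⟩))
    · exact Or.inl ⟨rfl, rfl, h⟩
    · exact Or.inr (Or.inr (Or.inl ⟨rfl, rfl, h⟩))
    · exact Or.inr (Or.inl ⟨rfl, by ring, h⟩)
    · refine Or.inr (Or.inr (Or.inr ⟨rfl, by ring, ?_⟩))
      rw [add_sub_cancel_right]
      exact h
  · rintro (⟨rfl, rfl, h⟩ | ⟨rfl, rfl, h⟩ | ⟨rfl, rfl, h⟩ | ⟨rfl, rfl, h⟩)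
    · exact Or.inl (Or.inl ⟨⟨rfl, rfl⟩, h⟩)
    · exact Or.inr (Or.inl ⟨⟨by ring, rfl⟩, h⟩)
    · exact Or.inl (Or.inr ⟨⟨rfl, rfl⟩, h⟩)
    · exact Or.inr (Or.inr ⟨⟨rfl, by ring⟩, h⟩)

theorem matchingNumber_pinecone (hm : m = i + j) (hs : s = i - n - 1) (hj : 0 < j) (hk : j ≤ k)
    (hl : j ≤ ℓ) : matchingNumber (pinecone n i j k ℓ) = num m j k ℓ s := by
  have hj' : (0 : ℤ) < j := by exact_mod_cast hj
  have par : ∀ κ r : ℤ, Odd (bd m j κ s r 0 + r) := fun κ r => odd_bd_add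
  have verts : ∀ v, v ∈ (pinecone n i j k ℓ).verts ↔ (v.1, v.2) ∈ pineVerts i j k ℓ n := fun v =>
    Iff.rfl
  refine matchingNumber_eq_ncard _ (Bl_finite hj' (by exact_mod_cast hk) (by exact_mod_cast hl))
    (fun b hb => hb.1) ?_ ?_ ?_
  · rintro ⟨x, y⟩ ⟨u, hu⟩
    simp only at hu
    obtain ⟨v, hv⟩ := par k (y - 1)
    obtain ⟨v', hv'⟩ := par ℓ (-y)
    rw [verts, mem_pineVerts_iff hm hs]
    simp only [Bl, Set.mem_ofPred_eq]
    rw [and_iff_right (show Even (x + y) from ⟨u, hu⟩)]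
    omega
  · rintro ⟨x, y⟩ ⟨u, hu⟩
    simp only at hu
    obtain ⟨v, hv⟩ := par k (y - 1)
    obtain ⟨v', hv'⟩ := par ℓ (-y)
    rw [verts, mem_pineVerts_iff hm hs]
    simp only [Bl, Set.mem_ofPred_eq, eps]
    by_cases hy : 0 < y
    · rw [if_pos hy, and_iff_right (show Even (x + 1 + y) from ⟨u + 1, by omega⟩)]
      omega
    · rw [if_neg hy, and_iff_right (show Even (x + -1 + y) from ⟨u, by omega⟩)]
      omega
  · rintro ⟨x, y⟩ hb ⟨x', y'⟩ hc
    obtain ⟨⟨u, hu⟩, hb2⟩ := hb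
    obtain ⟨⟨v, hv⟩, hc2⟩ := hc
    simp only at hu hb2 hv hc2
    rw [pinecone_adj_iff]
    simp only [Arc, HEdge_iff hm hs, mem_pineVerts_iff hm hs, mem_oddSet_iff hm hs]
    have hE : Even (x + y) := ⟨u, hu⟩
    have hE' : ¬ Even (x + (y - 1)) := by rw [Int.even_iff]; omega
    simp only [hE, hE', true_or, and_true, false_or]
    obtain ⟨z, hz⟩ := par k (y - 1)
    obtain ⟨z', hz'⟩ := par ℓ (-y)
    rw [← or_assoc]
    refine or_congr ?_ (or_congr ?_ ?_)
    · constructor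
      · rintro (⟨h1, h2, h3⟩ | ⟨h1, h2, h3⟩)
        all_goals
          subst h1
          refine ⟨rfl, ?_⟩
          simp only [eps] at *
          split_ifs at * <;> omega
      · rintro ⟨h1, h2⟩
        subst h1
        simp only [eps, true_and] at *
        split_ifs at * <;> omega
    · constructor
      · rintro ⟨h1, h2, -⟩
        exact ⟨h2, by omega⟩
      · rintro ⟨h1, h2⟩
        subst h1
        refine ⟨by omega, rfl, by omega, ?_⟩
        simp only [eps] at *
        split_ifs at * <;> omega
    · constructor
      · rintro ⟨h1, h2, -, -, h3⟩
        refine ⟨h2, by omega, ?_⟩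
        rcases h3 with h | h
        · exact Or.inl ⟨h.1, h.2.2⟩
        · exact Or.inr ⟨h.1, h.2.2⟩
      · rintro ⟨h1, h2, h3⟩
        subst h1
        refine ⟨by omega, rfl, ?_, by omega, ?_⟩
        · simp only [eps] at *
          split_ifs at * <;> omega
        · rcases h3 with ⟨h, h'⟩ | ⟨h, h'⟩
          · exact Or.inl ⟨h, by simp only at h; omega, h'⟩
          · simp only at h h'
            rw [eps, if_neg (by omega)] at h2
            refine Or.inr ⟨h, by omega, h'⟩

end pinecone

section shape

variable {i j k ℓ n : ℕ} {m s : ℤ}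

theorem exists_last_row {m j κ s : ℤ} (hj : 0 < j) (hκ : j ≤ κ) (h0 : 0 < bd m j κ s 0 0) :
    ∃ R, 0 ≤ R ∧ ∀ r, 0 ≤ r → (r < bd m j κ s r 0 ↔ r ≤ R) := by
  obtain ⟨R, ⟨hR, hR'⟩, hmax⟩ := Int.exists_greatest_of_bdd
    (P := fun r => 0 ≤ r ∧ r < bd m j κ s r 0) ⟨bd m j κ s 0 0, fun r ⟨h1, h2⟩ => by
      have := bd_row (m := m) (s := s) (c := 0) hj hκ h1
      omega⟩ ⟨0, le_rfl, h0⟩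
  refine ⟨R, hR, fun r hr => ⟨fun h => hmax r ⟨hr, h⟩, fun h => ?_⟩⟩
  have := bd_row (m := m) (s := s) (c := 0) hj hκ h
  omega

theorem mem_oddSet_verts (hm : m = i + j) (hs : s = i - n - 1) (hj : 0 < j) (hji : j ≤ i)
    (hk : j ≤ k) (hl : j ≤ ℓ) {x y : ℤ} (h : (x, y) ∈ oddSet i j k ℓ n) :
    Odd (x + y) ∧ (x, y) ∈ pineVerts i j k ℓ n ∧ (x, y + 1) ∈ pineVerts i j k ℓ n := by
  have hj' : (0 : ℤ) < j := by exact_mod_cast hj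
  have hm2 : 2 * (j : ℤ) ≤ m := by omega
  have hk' : (j : ℤ) ≤ k := by exact_mod_cast hk
  have hl' : (j : ℤ) ≤ ℓ := by exact_mod_cast hl
  have h00 : bd m j k s 0 0 = bd m j ℓ s 0 0 := bd_zero _
  rw [mem_oddSet_iff hm hs] at h
  rw [mem_pineVerts_iff hm hs, mem_pineVerts_iff hm hs, add_sub_cancel_right]
  rcases h with ⟨h1, h2, c, hc, h3⟩ | ⟨h1, h2, c, hc, h3⟩
  · have h4 := bd_col (κ := k) (s := s) (r := y) hj' hm2 hc
    refine ⟨by rw [h3]; exact odd_bd_add, ?_, by omega⟩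
    rcases h1.eq_or_lt with rfl | h1
    · rw [neg_zero]; omega
    · have h5 := bd_row (m := m) (s := s) (c := 0) hj' hk' (show y - 1 ≤ y by omega)
      omega
  · have h4 := bd_col (κ := ℓ) (s := s) (r := -y) hj' hm2 hc
    refine ⟨?_, by omega, ?_⟩
    · obtain ⟨u, hu⟩ := odd_bd_add (m := m) (j := j) (κ := ℓ) (s := s) (r := -y) (c := c)
      exact ⟨u + y, by omega⟩
    · rcases h1.eq_or_lt with rfl | h1
      · rw [neg_zero] at *; omega
      · have h5 := bd_row (m := m) (s := s) (c := 0) hj' hl' (show -(y + 1) ≤ -y by omega)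
        omega

theorem oddEdges_pinecone (hj : 0 < j) (hji : j ≤ i) (hk : j ≤ k) (hl : j ≤ ℓ) :
    oddEdges (pinecone n i j k ℓ) = oddSet i j k ℓ n := by
  ext ⟨x, y⟩
  simp only [oddEdges, Set.mem_ofPred_eq, pinecone_adj_iff]
  constructor
  · rintro ⟨h1, h | h | h | h⟩
    · omega
    · omega
    · rcases h.2.2.2.2 with h2 | h2
      · exact absurd h2 (Int.not_even_iff_odd.2 h1)
      · exact h2
    · omega
  · intro h
    obtain ⟨h1, h2, h3⟩ := mem_oddSet_verts rfl rfl hj hji hk hl h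
    exact ⟨h1, Or.inr (Or.inr (Or.inl ⟨trivial, trivial, h2, h3, Or.inr h⟩))⟩

theorem pinecone_verts_subset (hm : m = i + j) (hs : s = i - n - 1) (hj : 0 < j) (hk : j ≤ k)
    (hl : j ≤ ℓ) : (pinecone n i j k ℓ).verts ⊆ {p | 0 < bd m j k s 0 0 ∧
      p ∈ Set.Icc 0 (bd m j k s 0 0) ×ˢ Set.Icc (-bd m j k s 0 0) (bd m j k s 0 0)} := by
  have hj' : (0 : ℤ) < j := by exact_mod_cast hj
  rintro ⟨x, y⟩ h
  have h00 : bd m j k s 0 0 = bd m j ℓ s 0 0 := bd_zero _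
  simp only [Set.mem_ofPred_eq, Set.mem_prod, Set.mem_Icc]
  rcases (mem_pineVerts_iff hm hs x y).1 h with ⟨h1, h2⟩ | ⟨h1, h2⟩
  · have := bd_row (m := m) (κ := k) (s := s) (c := 0) hj' (by exact_mod_cast hk)
      (show 0 ≤ y - 1 by omega)
    omega
  · have := bd_row (m := m) (κ := ℓ) (s := s) (c := 0) hj' (by exact_mod_cast hl)
      (show 0 ≤ -y by omega)
    omega

theorem pinecone_verts_finite (hj : 0 < j) (hk : j ≤ k) (hl : j ≤ ℓ) :
    (pinecone n i j k ℓ).verts.Finite :=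
  ((Set.finite_Icc _ _).prod (Set.finite_Icc _ _)).subset fun _ hp =>
    (pinecone_verts_subset rfl rfl hj hk hl hp).2

theorem pinecone_eq_bot (hm : m = i + j) (hs : s = i - n - 1) (hj : 0 < j) (hk : j ≤ k)
    (hl : j ≤ ℓ) (hw : bd m j k s 0 0 ≤ 0) : pinecone n i j k ℓ = ⊥ := by
  have hv : ∀ v, v ∉ (pinecone n i j k ℓ).verts := fun v hv =>
    absurd (pinecone_verts_subset hm hs hj hk hl hv).1 (not_lt.2 hw)
  refine SimpleGraph.Subgraph.ext (Set.eq_empty_of_forall_notMem hv) ?_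
  ext v w
  exact iff_of_false (fun h => hv v ((pinecone n i j k ℓ).edge_vert h)) (by simp)

theorem ncard_neighborSet_ne_one {V : Type*} {G : SimpleGraph V} {P : G.Subgraph} {v a b : V}
    (ha : P.Adj v a) (hb : P.Adj v b) (hab : a ≠ b) : (P.neighborSet v).ncard ≠ 1 := by
  intro h
  obtain ⟨c, hc⟩ := Set.ncard_eq_one.1 h
  have h1 : a ∈ P.neighborSet v := ha
  have h2 : b ∈ P.neighborSet v := hb
  rw [hc] at h1 h2
  exact hab (h1.trans h2.symm)

theorem pinecone_degree (hj : 0 < j) (hji : j ≤ i) (hk : j ≤ k) (hl : j ≤ ℓ) {v : ℤ × ℤ}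
    (hv : v ∈ (pinecone n i j k ℓ).verts) : ((pinecone n i j k ℓ).neighborSet v).ncard ≠ 1 := by
  obtain ⟨m, hm⟩ : ∃ m : ℤ, m = i + j := ⟨_, rfl⟩
  obtain ⟨s, hs⟩ : ∃ s : ℤ, s = i - n - 1 := ⟨_, rfl⟩
  have hj' : (0 : ℤ) < j := by exact_mod_cast hj
  have hk' : (j : ℤ) ≤ k := by exact_mod_cast hk
  have hl' : (j : ℤ) ≤ ℓ := by exact_mod_cast hl
  have h00 : bd m j k s 0 0 = bd m j ℓ s 0 0 := bd_zero _
  obtain ⟨x, y⟩ := v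
  have vert := mem_pineVerts_iff (k := k) (ℓ := ℓ) hm hs
  have hedge := HEdge_iff (k := k) (ℓ := ℓ) hm hs
  have odd := mem_oddSet_iff (k := k) (ℓ := ℓ) hm hs
  have hv' := hv
  change (x, y) ∈ pineVerts i j k ℓ n at hv hv'
  by_cases hr : HEdge i j k ℓ n x y
  · have a1 : (pinecone n i j k ℓ).Adj (x, y) (x + 1, y) :=
      (pinecone_adj_iff _ _ _ _).2 (Or.inl ⟨rfl, rfl, hr⟩)
    by_cases hl : HEdge i j k ℓ n (x - 1) y
    · exact ncard_neighborSet_ne_one a1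
        ((pinecone_adj_iff _ _ _ _).2 (Or.inr (Or.inl ⟨rfl, rfl, hl⟩))) (by simp; omega)
    · rw [vert] at hv
      rw [hedge] at hr hl
      by_cases hy : 1 ≤ y
      · refine ncard_neighborSet_ne_one a1 (b := (x, y - 1)) ((pinecone_adj_iff _ _ _ _).2
          (Or.inr (Or.inr (Or.inr ⟨rfl, rfl, ?_, hv', Or.inl ⟨y - 1, by omega⟩⟩)))) (by simp)
        rw [vert]
        rcases hy.eq_or_lt with rfl | hy
        · simp only [sub_self, neg_zero] at *
          omega
        · have := bd_row (m := m) (s := s) (c := 0) hj' hk' (show y - 1 - 1 ≤ y - 1 by omega)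
          omega
      · refine ncard_neighborSet_ne_one a1 (b := (x, y + 1)) ((pinecone_adj_iff _ _ _ _).2
          (Or.inr (Or.inr (Or.inl ⟨rfl, rfl, hv', ?_, Or.inl ⟨0, by omega⟩⟩)))) (by simp)
        rw [vert]
        rcases (show y ≤ 0 by omega).eq_or_lt with rfl | hy
        · simp only [zero_add, sub_self, neg_zero] at *
          omega
        · have := bd_row (m := m) (s := s) (c := 0) hj' hl' (show -(y + 1) ≤ -y by omega)
          omega
  · have hl : HEdge i j k ℓ n (x - 1) y := hv.resolve_left hr
    have a1 : (pinecone n i j k ℓ).Adj (x, y) (x - 1, y) :=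
      (pinecone_adj_iff _ _ _ _).2 (Or.inr (Or.inl ⟨rfl, rfl, hl⟩))
    rw [hedge] at hr hl
    by_cases hy : 1 ≤ y
    · have ho : (x, y - 1) ∈ oddSet i j k ℓ n := by
        rw [odd]
        exact Or.inl ⟨by omega, by omega, 0, le_rfl, by omega⟩
      obtain ⟨-, h1, -⟩ := mem_oddSet_verts rfl rfl hj hji hk ‹_› ho
      exact ncard_neighborSet_ne_one a1 (b := (x, y - 1)) ((pinecone_adj_iff _ _ _ _).2
        (Or.inr (Or.inr (Or.inr ⟨rfl, rfl, h1, hv', Or.inr ho⟩)))) (by simp)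
    · have ho : (x, y) ∈ oddSet i j k ℓ n := by
        rw [odd]
        exact Or.inr ⟨by omega, by omega, 0, le_rfl, by omega⟩
      obtain ⟨-, -, h1⟩ := mem_oddSet_verts rfl rfl hj hji hk ‹_› ho
      exact ncard_neighborSet_ne_one a1 (b := (x, y + 1)) ((pinecone_adj_iff _ _ _ _).2
        (Or.inr (Or.inr (Or.inl ⟨rfl, rfl, hv', h1, Or.inr ho⟩)))) (by simp)

theorem isStandardPinecone_pinecone (hm : m = i + j) (hs : s = i - n - 1) (hj : 0 < j)
    (hk : j ≤ k) (hl : j ≤ ℓ) (hw : 0 < bd m j k s 0 0) :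
    IsStandardPinecone (pinecone n i j k ℓ) := by
  have hj' : (0 : ℤ) < j := by exact_mod_cast hj
  have hk' : (j : ℤ) ≤ k := by exact_mod_cast hk
  have hl' : (j : ℤ) ≤ ℓ := by exact_mod_cast hl
  have h00 : bd m j k s 0 0 = bd m j ℓ s 0 0 := bd_zero _
  obtain ⟨R, hR, hR'⟩ := exists_last_row hj' hk' hw
  obtain ⟨T, hT, hT'⟩ := exists_last_row hj' hl' (h00 ▸ hw)
  have horiz : ∀ x y : ℤ, (pinecone n i j k ℓ).Adj (x, y) (x + 1, y) ↔ HEdge i j k ℓ n x y := by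
    intro x y
    rw [pinecone_adj_iff]
    refine ⟨fun h => ?_, fun h => Or.inl ⟨rfl, rfl, h⟩⟩
    rcases h with h | h | h | h
    · exact h.2.2
    all_goals omega
  refine ⟨R + 1, T, bd m j k s 0 0,
    fun y => if 1 ≤ y then bd m j k s (y - 1) 0 - (y - 1) else bd m j ℓ s (-y) 0 + y,
    by omega, hT, ?_, ?_, ?_, ?_, ?_, ?_, ?_, ?_⟩
  · rintro y ⟨h1, h2⟩
    simp only
    split_ifs with hy
    · have := (hR' (y - 1) (by omega)).2 (by omega)
      obtain ⟨u, hu⟩ := odd_bd_add (m := m) (j := j) (κ := k) (s := s) (r := y - 1) (c := 0)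
      exact ⟨by omega, u - (y - 1), by omega⟩
    · have := (hT' (-y) (by omega)).2 (by omega)
      obtain ⟨u, hu⟩ := odd_bd_add (m := m) (j := j) (κ := ℓ) (s := s) (r := -y) (c := 0)
      exact ⟨by omega, u + y, by omega⟩
  · simp [h00]
  · simp
  · rintro y ⟨h1, h2⟩ y' ⟨h3, h4⟩ h
    have := bd_row (m := m) (s := s) (c := 0) hj' hl' (show -y' ≤ -y by omega)
    simp only
    rw [if_neg (by omega), if_neg (by omega)]
    omega
  · rintro y ⟨h1, h2⟩ y' ⟨h3, h4⟩ h
    have := bd_row (m := m) (s := s) (c := 0) hj' hk' (show y - 1 ≤ y' - 1 by omega)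
    simp only
    rw [if_pos (by omega), if_pos (by omega)]
    omega
  · intro x y
    rw [horiz, HEdge_iff hm hs, Set.mem_Icc]
    simp only [segStart]
    split_ifs with hy
    · have := hR' (y - 1) (by omega)
      omega
    · have := hT' (-y) (by omega)
      omega
  · intro x y
    have := horiz (x - 1) y
    rw [sub_add_cancel] at this
    rw [horiz, this]
    rfl
  · intro x y h1 h2 h3
    rw [pinecone_adj_iff]
    exact Or.inr (Or.inr (Or.inl ⟨rfl, rfl, h2, h3, Or.inl h1⟩))

theorem isClosedStandardPinecone_pinecone (hj : 0 < j) (hji : j ≤ i) (hk : j ≤ k) (hl : j ≤ ℓ) :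
    IsClosedStandardPinecone (pinecone n i j k ℓ) := by
  rcases le_or_gt (bd (i + j) j k (i - n - 1) 0 0) 0 with h | h
  · exact Or.inl (pinecone_eq_bot rfl rfl hj hk hl h)
  · exact Or.inr ⟨isStandardPinecone_pinecone rfl rfl hj hk hl h,
      fun v hv => pinecone_degree hj hji hk hl hv⟩

theorem num_eq_one {m j k l s : ℤ} (hj : 0 < j) (hk : j ≤ k) (hl : j ≤ l)
    (hw : bd m j k s 0 0 < 0) : num m j k l s = 1 := by
  have hB : ∀ p, p ∉ Bl m j k l s := by
    intro p hp
    have := (Bl_subset hj hk hl hp).1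
    rw [Set.mem_Icc] at this
    omega
  rw [num, Set.ncard_eq_one]
  refine ⟨1, Set.eq_singleton_iff_unique_mem.2 ⟨⟨fun _ _ => rfl, fun b => Arc.rfl' b⟩, ?_⟩⟩
  intro π hπ
  exact Equiv.ext fun b => hπ.1 b (hB b)

end shape

end GaleRobinson

theorem mainTheorem1 (i j k ℓ m : ℕ) (hi : 0 < i) (hj : 0 < j) (hk : 0 < k) (hl : 0 < ℓ)
    (hij : i + j = m) (hkl : k + ℓ = m) (hji : j ≤ i) (hjk : j ≤ k) (hjl : j ≤ ℓ) :
    (∀ n : ℕ, GaleRobinson.IsClosedStandardPinecone (GaleRobinson.pinecone n i j k ℓ) ∧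
      GaleRobinson.oddEdges (GaleRobinson.pinecone n i j k ℓ) = GaleRobinson.oddSet i j k ℓ n ∧
      (GaleRobinson.pinecone n i j k ℓ).verts.Finite) ∧
    (∀ n : ℕ, n < m →
      GaleRobinson.matchingNumber (GaleRobinson.pinecone n i j k ℓ) = 1) ∧
    (∀ n : ℕ, m ≤ n →
      GaleRobinson.matchingNumber (GaleRobinson.pinecone n i j k ℓ) *
          GaleRobinson.matchingNumber (GaleRobinson.pinecone (n - m) i j k ℓ) =
        GaleRobinson.matchingNumber (GaleRobinson.pinecone (n - i) i j k ℓ) *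
            GaleRobinson.matchingNumber (GaleRobinson.pinecone (n - j) i j k ℓ) +
          GaleRobinson.matchingNumber (GaleRobinson.pinecone (n - k) i j k ℓ) *
            GaleRobinson.matchingNumber (GaleRobinson.pinecone (n - ℓ) i j k ℓ)) := by
  open GaleRobinson in
  have hj' : (0 : ℤ) < j := by exact_mod_cast hj
  have hk' : (j : ℤ) ≤ k := by exact_mod_cast hjk
  have hl' : (j : ℤ) ≤ ℓ := by exact_mod_cast hjl
  refine ⟨fun n => ⟨isClosedStandardPinecone_pinecone hj hji hjk hjl,
    oddEdges_pinecone hj hji hjk hjl, pinecone_verts_finite hj hjk hjl⟩, fun n hn => ?_,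
    fun n hn => ?_⟩
  · rw [matchingNumber_pinecone (m := i + j) (s := i - n - 1) rfl rfl hj hjk hjl]
    refine num_eq_one hj' hk' hl' ?_
    have : -1 ≤ ((i : ℤ) - n - 1) / j := by
      rw [Int.le_ediv_iff_mul_le hj']
      omega
    simp only [bd, mul_zero, zero_add]
    omega
  · have hw : 1 ≤ bd m j k (i - n - 1) 0 0 := by
      have : ((i : ℤ) - n - 1) / j < -1 := by
        rw [Int.ediv_lt_iff_lt_mul hj']
        omega
      simp only [bd, mul_zero, zero_add]
      omega
    have hmn : ∀ d : ℕ, d ≤ n → matchingNumber (pinecone (n - d) i j k ℓ) =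
        num m j k ℓ (i - n - 1 + d) := by
      intro d hd
      exact matchingNumber_pinecone (by omega) (by omega) hj hjk hjl
    have h0 := hmn 0 (by omega)
    rw [Nat.sub_zero, Nat.cast_zero, add_zero] at h0
    rw [h0, hmn m hn, hmn i (by omega), hmn j (by omega), hmn k (by omega), hmn ℓ (by omega)]
    have key := num_recurrence (s := i - n - 1) (m := m) hj' hk' hl' (by omega) hw
    rwa [show (m : ℤ) - j = i by omega] at key
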